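/- Let $(M,\langle\,,\rangle)$ be a $C^\infty$ Riemannian manifold of dimension $n\ge 2$, and give $M\times\mathbb{R}$ the product metric $\langle\,,\rangle+dt^2$. For an immersed hypersurface with unit normal field $N$, the shape operator is $AX=-\nabla_XN$ and the mean curvature is the (non-normalized) trace of $A$. Let $\Sigma_0$ be an $(n-1)$-dimensional manifold and $I\subset\mathbb{R}$ a nonempty open interval. A family of parallel hypersurfaces $f_s:\Sigma_0\to M$, $s\in I$, is a smooth family of immersions such that, for some $s_1\in I$ and some unit normal field $\eta$ of $f_{s_1}$, $f_s(p)=\exp_M\big(f_{s_1}(p),(s-s_1)\eta(p)\big)$ for all $s\in I$, $p\in\Sigma_0$; $f_s$ is oriented by the unit normal $\eta_s(p)=\partial_sf_s(p)$. The family is isoparametric if each $f_s$ has constant mean curvature $H_s$ (depending only on $s$). Given moreover a smooth function $a:I\to\mathbb{R}$ with $a'>0$, the hypersurface $\Sigma=\{(f_s(p),a(s)) : p\in\Sigma_0,\ s\in I\}\subset M\times\mathbb{R}$ (parametrized by $(p,s)$) is called an $(f_s,a)$-graph; it is oriented by the unit normal $N=(1+a'^2)^{-1/2}(-a'\eta_s+\partial_t)$,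 and its angle function is $\theta=\langle N,\partial_t\rangle$. (1) Let $\Sigma$ be an $(f_s,a)$-graph such that the family $f_s$ is isoparametric with mean curvatures $H_s$, let $H\in\mathbb{R}$ and $s_0\in I$, and suppose that $$a(s)=a(s_0)+\int_{s_0}^s\frac{\varrho(\tau)}{\sqrt{1-\varrho(\tau)^2}}\,d\tau,\qquad s\in I, \tag{$*$}$$ where $\varrho$ is a solution on $I$ of $y'=H_sy+H$ with $0<\varrho<1$. Then $\Sigma$ has constant mean curvature $H$. (2) Conversely, if an $(f_s,a)$-graph $\Sigma$ has constant mean curvature $H$, then the family $f_s$ is isoparametric, $\varrho:=a'\theta$ depends only on $s$, satisfies $0<\varrho<1$ and $\varrho'=H_s\varrho+H$ on $I$, where $H_s$ is the mean curvature of $f_s$, and $a$ is given by $(*)$ for every $s_0\in I$. (3) Consequently, for every $H\in\mathbb{R}$, there is an $(f_s,a)$-graph (with $\Sigma_0\neq\emptyset$) of constant mean curvature $H$ in $M\times\mathbb{R}$ if and only if $M$ admits an isoparametric family of parallel hypersurfaces (with $\Sigma_0\ne\emptyset$); in particular this holds for minimal graphs ($H=0$). (4) Call an $(f_s,a)$-graph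 a vertical catenoid if $\theta^2\neq1$ everywhere, $\theta$ is not constant, the gradient $\nabla\xi$ of the height function $\xi$ of $\Sigma$ is a principal direction with principal curvature $\lambda\ne0$, and every horizontal section $f_s(\Sigma_0)\times\{a(s)\}$ has (with respect to $\eta_s$) nonzero constant mean curvature, equal to $\lambda/\sqrt{1-\theta^2}$. There is an $(f_s,a)$-graph (with $\Sigma_0\neq\emptyset$) which is a vertical catenoid in $M\times\mathbb{R}$ if and only if $M$ admits an isoparametric family of parallel hypersurfaces (with $\Sigma_0\ne\emptyset$) that are not all minimal, i.e. with $H_s\neq0$ for some $s$. -/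

import Mathlib

open scoped Manifold ContDiff Bundle

universe u w

noncomputable section

section Riemannian

variable {E : Type*} [NormedAddCommGroup E] [NormedSpace ℝ E]
  {H : Type*} [TopologicalSpace H] {I : ModelWithCorners ℝ E H}
  {M : Type*} [TopologicalSpace M] [ChartedSpace H M]
  {E' : Type*} [NormedAddCommGroup E'] [NormedSpace ℝ E']
  {H' : Type*} [TopologicalSpace H'] {I' : ModelWithCorners ℝ E' H'}
  {S : Type*} [TopologicalSpace S] [ChartedSpace H' S]

/-- The metric `g` read in the preferred chart at `x₀`: at `y`, the bilinear form
`(v, w) ↦ ∑ g_ij(y) v^i w^j`, i.e. the pull-back of `g` under the inverse chart. -/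
def chartMetric (g : ∀ x : M, TangentSpace I x →L[ℝ] TangentSpace I x →L[ℝ] ℝ) (x₀ : M) (y : E) :
    E →L[ℝ] E →L[ℝ] ℝ :=
  let gy : E →L[ℝ] E →L[ℝ] ℝ := g ((extChartAt I x₀).symm y)
  let B : E →L[ℝ] E := mfderiv 𝓘(ℝ, E) I (extChartAt I x₀).symm y
  gy.bilinearComp B B

/-- The Christoffel symbols of the Levi-Civita connection of `g` at `x₀`, in the preferred chart
at `x₀`: `christoffel g x₀ v w = (∑ Γ^k_ij v^i w^j)_k` is the vector `u` such that
`g(u, z) = (1/2) (∂_v g(w, z) + ∂_w g(v, z) - ∂_z g(v, w))` for all `z`. -/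
def christoffel (g : ∀ x : M, TangentSpace I x →L[ℝ] TangentSpace I x →L[ℝ] ℝ) (x₀ : M)
    (v w : E) : E :=
  let D := fderiv ℝ (chartMetric g x₀) (extChartAt I x₀ x₀)
  (chartMetric g x₀ (extChartAt I x₀ x₀)).inverse
    ((1 / 2 : ℝ) • (D v w + D w v - (D.flip v).flip w))

/-- The (Levi-Civita) covariant derivative `∇_X N` at `p`, for a vector field `N` along a map
`F : S → M` and a tangent vector `X` of `S` at `p`. The formula is
`X(N^k) + Γ^k_ij dF(X)^i N^j` in the preferred chart at `F p`; recall that Mathlib's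
`TangentSpace I x` is the model space, a tangent vector at `x` being given by its coordinates in the
preferred chart at `x`. -/
def covDerivAlong (g : ∀ x : M, TangentSpace I x →L[ℝ] TangentSpace I x →L[ℝ] ℝ)
    (F : S → M) (N : ∀ p : S, TangentSpace I (F p)) (p : S) (X : TangentSpace I' p) :
    TangentSpace I (F p) :=
  let Ncoord : S → E := fun q => mfderiv I 𝓘(ℝ, E) (extChartAt I (F p)) (F q) (N q)
  let dN : E := mfderiv I' 𝓘(ℝ, E) Ncoord p X
  dN + christoffel g (F p) (mfderiv I' I F p X) (N p)

/-- The velocity `γ'(s)` of a curve `γ` in `M`. -/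
def velocity (I : ModelWithCorners ℝ E H) (γ : ℝ → M) (s : ℝ) : TangentSpace I (γ s) :=
  mfderiv 𝓘(ℝ, ℝ) I γ s (1 : ℝ)

/-- `N` is, at `p`, a unit vector which is normal to the hypersurface `F : S → M`. -/
def IsUnitNormalAt (I' : ModelWithCorners ℝ E' H')
    (g : ∀ x : M, TangentSpace I x →L[ℝ] TangentSpace I x →L[ℝ] ℝ)
    (F : S → M) (N : ∀ p : S, TangentSpace I (F p)) (p : S) : Prop :=
  g (F p) (N p) (N p) = 1 ∧ ∀ X : TangentSpace I' p, g (F p) (N p) (mfderiv I' I F p X) = 0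

/-- `A` is the shape operator at `p` of the immersed hypersurface `F : S → M` relative to the
unit normal field `N`: `A X = -∇_X N` (as tangent vectors of `M`, through `dF`). -/
def IsShapeOperatorAt (g : ∀ x : M, TangentSpace I x →L[ℝ] TangentSpace I x →L[ℝ] ℝ)
    (F : S → M) (N : ∀ p : S, TangentSpace I (F p)) (p : S)
    (A : TangentSpace I' p →ₗ[ℝ] TangentSpace I' p) : Prop :=
  ∀ X : TangentSpace I' p, mfderiv I' I F p (A X) = -covDerivAlong g F N p X

/-- On the set `U`, the immersed hypersurface `F : S → M` with unit normal field `N` has constant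
(non-normalized) mean curvature `h`, i.e. the trace of the shape operator is `h` on `U`. -/
def HasConstMeanCurvatureOn (I' : ModelWithCorners ℝ E' H')
    (g : ∀ x : M, TangentSpace I x →L[ℝ] TangentSpace I x →L[ℝ] ℝ)
    (F : S → M) (N : ∀ p : S, TangentSpace I (F p)) (U : Set S) (h : ℝ) : Prop :=
  ∀ p ∈ U, Function.Injective (mfderiv I' I F p) ∧ IsUnitNormalAt I' g F N p ∧
    ∃ A : TangentSpace I' p →ₗ[ℝ] TangentSpace I' p,
      IsShapeOperatorAt g F N p A ∧ LinearMap.trace ℝ (TangentSpace I' p) A = h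

/-- `γ` is a geodesic on `J`: `∇_{γ'} γ' = 0`. -/
def IsGeodesicOn (g : ∀ x : M, TangentSpace I x →L[ℝ] TangentSpace I x →L[ℝ] ℝ)
    (γ : ℝ → M) (J : Set ℝ) : Prop :=
  ContMDiffOn 𝓘(ℝ, ℝ) I ∞ γ J ∧
    ∀ s ∈ J, covDerivAlong (I' := 𝓘(ℝ, ℝ)) g γ (velocity I γ) s (1 : ℝ) = 0

/-- The field `η_s(p) = γ_p'(s)` along `f_s`, where `γ_p(s) = f_s(p)`. -/
def familyNormal (I : ModelWithCorners ℝ E H) (f : ℝ → S → M) (s : ℝ) (p : S) :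
    TangentSpace I (f s p) :=
  velocity I (fun r => f r p) s

/-- `f_s : S → M`, `s ∈ J` (an open interval), is a family of parallel hypersurfaces: the curves
`s ↦ f_s(p)` are geodesics whose initial velocity, at some base parameter `s₁ ∈ J`, is a unit normal
field `η` of `f_{s₁}`, i.e. `f_s(p) = exp (f_{s₁}(p), (s - s₁) η(p))`, the family is smooth, and all
`f_s` are immersions. -/
structure IsParallelFamily (I' : ModelWithCorners ℝ E' H')
    (g : ∀ x : M, TangentSpace I x →L[ℝ] TangentSpace I x →L[ℝ] ℝ)
    (J : Set ℝ) (f : ℝ → S → M) : Prop where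
  isOpen : IsOpen J
  ordConnected : J.OrdConnected
  smooth : ContMDiffOn (I'.prod 𝓘(ℝ, ℝ)) I ∞ (fun x : S × ℝ => f x.2 x.1) (Set.univ ×ˢ J)
  immersion : ∀ s ∈ J, ∀ p, Function.Injective (mfderiv I' I (f s) p)
  geodesic : ∀ p, IsGeodesicOn g (fun s => f s p) J
  normal : ∃ s₁ ∈ J, ∀ p, IsUnitNormalAt I' g (f s₁) (familyNormal I f s₁) p

/-- The family of parallel hypersurfaces `f_s`, `s ∈ J`, is isoparametric, `f_s` having constant
mean curvature `Hs s` (relative to `η_s`). -/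
def IsIsoparametric (I' : ModelWithCorners ℝ E' H')
    (g : ∀ x : M, TangentSpace I x →L[ℝ] TangentSpace I x →L[ℝ] ℝ)
    (J : Set ℝ) (f : ℝ → S → M) (Hs : ℝ → ℝ) : Prop :=
  IsParallelFamily I' g J f ∧
    ∀ s ∈ J, HasConstMeanCurvatureOn I' g (f s) (familyNormal I f s) Set.univ (Hs s)

/-- The Riemannian product metric `g + dt²` on `M × ℝ`. -/
def prodMetric (g : ∀ x : M, TangentSpace I x →L[ℝ] TangentSpace I x →L[ℝ] ℝ) (x : M × ℝ) :
    TangentSpace (I.prod 𝓘(ℝ, ℝ)) x →L[ℝ] TangentSpace (I.prod 𝓘(ℝ, ℝ)) x →L[ℝ] ℝ :=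
  let gx : E →L[ℝ] E →L[ℝ] ℝ := g x.1
  (gx.bilinearComp (ContinuousLinearMap.fst ℝ E ℝ) (ContinuousLinearMap.fst ℝ E ℝ) +
    (ContinuousLinearMap.mul ℝ ℝ).bilinearComp
      (ContinuousLinearMap.snd ℝ E ℝ) (ContinuousLinearMap.snd ℝ E ℝ) :
    E × ℝ →L[ℝ] E × ℝ →L[ℝ] ℝ)

/-- The vertical unit field `∂_t` of `M × ℝ`. -/
def verticalField (I : ModelWithCorners ℝ E H) (x : M × ℝ) : TangentSpace (I.prod 𝓘(ℝ, ℝ)) x :=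
  ((0, 1) : E × ℝ)

/-- The pair `(f, a)`, with parameter interval `J`, defines an `(f_s, a)`-graph: the `f_s` are
parallel hypersurfaces and `a` is an increasing diffeomorphism from `J` onto its image. -/
structure IsParallelGraph (I' : ModelWithCorners ℝ E' H')
    (g : ∀ x : M, TangentSpace I x →L[ℝ] TangentSpace I x →L[ℝ] ℝ)
    (J : Set ℝ) (f : ℝ → S → M) (a : ℝ → ℝ) : Prop where
  parallel : IsParallelFamily I' g J f
  smooth : ContDiffOn ℝ ∞ a J
  deriv_pos : ∀ s ∈ J, 0 < deriv a s

/-- The immersion `(p, s) ↦ (f_s(p), a(s))` (for `s` in the parameter interval) whose image is the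
`(f_s, a)`-graph. -/
def graphMap (f : ℝ → S → M) (a : ℝ → ℝ) (x : S × ℝ) : M × ℝ :=
  (f x.2 x.1, a x.2)

/-- The unit normal
`N = (1 + a'²)^{-1/2} (-a' η_s + ∂_t)` of the `(f_s, a)`-graph. -/
def graphNormal (I : ModelWithCorners ℝ E H) (f : ℝ → S → M) (a : ℝ → ℝ) (x : S × ℝ) :
    TangentSpace (I.prod 𝓘(ℝ, ℝ)) (graphMap f a x) :=
  let η : E := familyNormal I f x.2 x.1
  ((-(deriv a x.2) / √(1 + deriv a x.2 ^ 2)) • η, 1 / √(1 + deriv a x.2 ^ 2))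

/-- The angle function `θ = ⟨N, ∂_t⟩` of the `(f_s, a)`-graph. -/
def graphAngle (g : ∀ x : M, TangentSpace I x →L[ℝ] TangentSpace I x →L[ℝ] ℝ)
    (f : ℝ → S → M) (a : ℝ → ℝ) (x : S × ℝ) : ℝ :=
  prodMetric g (graphMap f a x) (graphNormal I f a x) (verticalField I (graphMap f a x))

/-- The `(f_s, a)`-graph `Σ` has constant mean curvature `h` in `M × ℝ` (relative to `N`). -/
def GraphHasConstMeanCurvature (I' : ModelWithCorners ℝ E' H')
    (g : ∀ x : M, TangentSpace I x →L[ℝ] TangentSpace I x →L[ℝ] ℝ)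
    (J : Set ℝ) (f : ℝ → S → M) (a : ℝ → ℝ) (h : ℝ) : Prop :=
  HasConstMeanCurvatureOn (I'.prod 𝓘(ℝ, ℝ)) (prodMetric g) (graphMap f a) (graphNormal I f a)
    (Set.univ ×ˢ J) h

/-- `T` is the gradient at `x` of the height function `ξ = π_ℝ ∘ F` of the immersed hypersurface
`F : S → M × ℝ`, with respect to the induced metric: `⟨dF T, dF X⟩ = dξ(X)` for all `X`. -/
def IsHeightGradientAt (g : ∀ x : M, TangentSpace I x →L[ℝ] TangentSpace I x →L[ℝ] ℝ)
    (F : S → M × ℝ) (x : S) (T : TangentSpace I' x) : Prop :=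
  ∀ X : TangentSpace I' x,
    prodMetric g (F x) (mfderiv I' (I.prod 𝓘(ℝ, ℝ)) F x T) (mfderiv I' (I.prod 𝓘(ℝ, ℝ)) F x X) =
      (mfderiv I' 𝓘(ℝ, ℝ) (fun y => (F y).2) x X : ℝ)

/-- The `(f_s, a)`-graph `Σ` is a vertical catenoid: it has no horizontal points (`θ² ≠ 1`), its
angle function is not constant, `∇ξ` is a principal direction with principal curvature
`lam ≠ 0`, and its horizontal sections have nonzero constant mean curvature
`lam / √(1 - θ²)`. The horizontal section of `Σ` at height `a(s)` is `f_s(S) × {a(s)}`, and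
`η_s = -(1 - θ²)^{-1/2} (N - θ ∂_t)` is its unit normal. -/
def GraphIsVerticalCatenoid (I' : ModelWithCorners ℝ E' H')
    (g : ∀ x : M, TangentSpace I x →L[ℝ] TangentSpace I x →L[ℝ] ℝ)
    (J : Set ℝ) (f : ℝ → S → M) (a : ℝ → ℝ) : Prop :=
  (∀ x ∈ (Set.univ ×ˢ J : Set (S × ℝ)), graphAngle g f a x ^ 2 ≠ 1) ∧
  (¬ ∃ c : ℝ, ∀ x ∈ (Set.univ ×ˢ J : Set (S × ℝ)), graphAngle g f a x = c) ∧
  ∃ (lam : S × ℝ → ℝ) (h : ℝ → ℝ),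
    (∀ x ∈ (Set.univ ×ˢ J : Set (S × ℝ)), lam x ≠ 0 ∧
      ∃ (A : TangentSpace (I'.prod 𝓘(ℝ, ℝ)) x →ₗ[ℝ] TangentSpace (I'.prod 𝓘(ℝ, ℝ)) x)
        (T : TangentSpace (I'.prod 𝓘(ℝ, ℝ)) x),
        IsShapeOperatorAt (prodMetric g) (graphMap f a) (graphNormal I f a) x A ∧
        IsHeightGradientAt g (graphMap f a) x T ∧ T ≠ 0 ∧ A T = lam x • T) ∧
    (∀ s ∈ J, h s ≠ 0 ∧
      HasConstMeanCurvatureOn I' g (f s) (familyNormal I f s) Set.univ (h s) ∧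
      ∀ p, h s = lam (p, s) / √(1 - graphAngle g f a (p, s) ^ 2))

end Riemannian

end

open scoped Manifold ContDiff Bundle

open Set Filter Topology

noncomputable section

set_option linter.unusedSectionVars false

/-! ### Tangent vectors and metrics as objects on the model space -/

section Coordinates

variable {E : Type*} [NormedAddCommGroup E] [NormedSpace ℝ E]
  {H : Type*} [TopologicalSpace H] {I : ModelWithCorners ℝ E H}
  {M : Type*} [TopologicalSpace M] [ChartedSpace H M]
  {E' : Type*} [NormedAddCommGroup E'] [NormedSpace ℝ E']
  {H' : Type*} [TopologicalSpace H'] {I' : ModelWithCorners ℝ E' H'}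
  {S : Type*} [TopologicalSpace S] [ChartedSpace H' S]

/-! Write `ρ = a' / √(1 + a'²)` (`graphSin a`) and `θ = 1 / √(1 + a'²)` (`graphCos a`), so that `N =
-ρ η_s + θ ∂_t`, `ρ = a' θ` and `ρ² + θ² = 1`. The identity `ρ² + θ² = 1` gives `θ' = -a' ρ'`. The
curves `s ↦ f_s(p)` are geodesics, so `∇_s η_s = 0`, and differentiating `N` along `(v, r)` leaves
`(-r ρ' η_s - ρ ∇_v η_s, -a' ρ' r)`. Since the differential of the graph map sends `(v, r)` to
`(df_s v + r η_s, a' r)`, the shape operator of the graph is block diagonal with blocks `-ρ A_s` and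
`ρ'` (`IsParallelGraph.coordDeriv_graphShape`). Its trace is `ρ' - ρ H_s`; hence mean curvature `H`
means exactly `ρ' = H_s ρ + H`. As `0 < ρ`, this can also be solved for `H_s`, which therefore
depends only on `s`. The formula for `a` only inverts `ρ = a' / √(1 + a'²)`.

For existence the linear equation must be solved with `0 < ρ < 1`, which is possible near any
parameter once `H_s` is smooth. Smoothness follows from the first variation formula `H_s = -(1/2) tr
(G⁻¹ G')`, where `G` is the metric induced by `f_s` at a fixed point (`trace_shape_eq`,
`contDiffOn_meanCurvature`). Choosing `H = 0` near a parameter with `H_s ≠ 0` gives a catenoid: `∇ξ`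
is a multiple of `∂_s`, a principal direction with curvature `ρ' = H_s ρ = H_s √(1 - θ²)`.

The covariant derivatives are computed in the preferred charts: `η` becomes the `s`-derivative of
`familyChart`, so `∇η` is a second derivative plus a Christoffel term, and the product metric adds
no Christoffel term in the `ℝ` direction (`christoffel_prodMetric`). -/

/-- The derivative of `F : S → M` at `p`, as a map between the model spaces. -/
def coordDeriv (I' : ModelWithCorners ℝ E' H') (I : ModelWithCorners ℝ E H) (F : S → M) (p : S) :
    E' →L[ℝ] E :=
  mfderiv I' I F p

/-- The metric at `x`, as a bilinear form on the model space. -/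
def coordMetric (g : ∀ x : M, TangentSpace I x →L[ℝ] TangentSpace I x →L[ℝ] ℝ) (x : M) :
    E →L[ℝ] E →L[ℝ] ℝ :=
  g x

/-- Vectors at `x` are already written in the preferred chart at `x`. This removes the chart
derivative at the base point; at nearby points it has to be kept. -/
lemma coordDeriv_extChartAt_self [IsManifold I 1 M] (x : M) :
    coordDeriv I 𝓘(ℝ, E) (extChartAt I x) x = ContinuousLinearMap.id ℝ E :=
  mfderiv_extChartAt_self

end Coordinates

/-! ### The metric read in a chart -/

section ChartMetric

variable {E : Type*} [NormedAddCommGroup E] [NormedSpace ℝ E]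
  {M : Type*} [TopologicalSpace M] [ChartedSpace E M]

lemma coordDeriv_extChartAt_symm_comp [IsManifold 𝓘(ℝ, E) ∞ M] {x₀ x : M}
    (hx : x ∈ (extChartAt 𝓘(ℝ, E) x₀).source) (v : E) :
    coordDeriv 𝓘(ℝ, E) 𝓘(ℝ, E) (extChartAt 𝓘(ℝ, E) x₀).symm (extChartAt 𝓘(ℝ, E) x₀ x)
      (coordDeriv 𝓘(ℝ, E) 𝓘(ℝ, E) (extChartAt 𝓘(ℝ, E) x₀) x v) = v := by
  have : IsManifold 𝓘(ℝ, E) 1 M := .of_le (n := ∞) (by simp)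
  have h := mfderivWithin_extChartAt_symm_comp_mfderiv_extChartAt' (I := 𝓘(ℝ, E)) hx
  rw [modelWithCornersSelf_coe, range_id, mfderivWithin_univ] at h
  exact congrArg (fun L => L v) h

lemma chartMetric_apply (g : ∀ x : M, TangentSpace 𝓘(ℝ, E) x →L[ℝ] TangentSpace 𝓘(ℝ, E) x →L[ℝ] ℝ)
    (x₀ : M) (y v w : E) :
    chartMetric g x₀ y v w = coordMetric g ((extChartAt 𝓘(ℝ, E) x₀).symm y)
      (coordDeriv 𝓘(ℝ, E) 𝓘(ℝ, E) (extChartAt 𝓘(ℝ, E) x₀).symm y v)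
      (coordDeriv 𝓘(ℝ, E) 𝓘(ℝ, E) (extChartAt 𝓘(ℝ, E) x₀).symm y w) := rfl

lemma chartMetric_coordDeriv [IsManifold 𝓘(ℝ, E) ∞ M]
    (g : ∀ x : M, TangentSpace 𝓘(ℝ, E) x →L[ℝ] TangentSpace 𝓘(ℝ, E) x →L[ℝ] ℝ) {x₀ x : M}
    (hx : x ∈ (extChartAt 𝓘(ℝ, E) x₀).source) (v w : E) :
    chartMetric g x₀ (extChartAt 𝓘(ℝ, E) x₀ x)
      (coordDeriv 𝓘(ℝ, E) 𝓘(ℝ, E) (extChartAt 𝓘(ℝ, E) x₀) x v)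
      (coordDeriv 𝓘(ℝ, E) 𝓘(ℝ, E) (extChartAt 𝓘(ℝ, E) x₀) x w) = coordMetric g x v w := by
  rw [chartMetric_apply, coordDeriv_extChartAt_symm_comp hx,
    coordDeriv_extChartAt_symm_comp hx, (extChartAt 𝓘(ℝ, E) x₀).left_inv hx]

lemma chartMetric_self [IsManifold 𝓘(ℝ, E) ∞ M]
    (g : ∀ x : M, TangentSpace 𝓘(ℝ, E) x →L[ℝ] TangentSpace 𝓘(ℝ, E) x →L[ℝ] ℝ) (x : M) :
    chartMetric g x (extChartAt 𝓘(ℝ, E) x x) = coordMetric g x := by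
  have : IsManifold 𝓘(ℝ, E) 1 M := .of_le (n := ∞) (by simp)
  ext v w
  have h := chartMetric_coordDeriv g (mem_extChartAt_source (I := 𝓘(ℝ, E)) x) v w
  rwa [coordDeriv_extChartAt_self] at h

lemma chartMetric_symm
    {g : ∀ x : M, TangentSpace 𝓘(ℝ, E) x →L[ℝ] TangentSpace 𝓘(ℝ, E) x →L[ℝ] ℝ}
    (hg : ∀ x v w, coordMetric g x v w = coordMetric g x w v) (x₀ : M) (y v w : E) :
    chartMetric g x₀ y v w = chartMetric g x₀ y w v := by
  rw [chartMetric_apply, chartMetric_apply, hg]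

end ChartMetric

/-! ### Smoothness and symmetry of the chart metric -/

section Smooth

variable {E : Type*} [NormedAddCommGroup E] [NormedSpace ℝ E] [FiniteDimensional ℝ E]
  {M : Type*} [TopologicalSpace M] [ChartedSpace E M] [IsManifold 𝓘(ℝ, E) ∞ M]
  (g : Bundle.ContMDiffRiemannianMetric 𝓘(ℝ, E) ∞ E (fun x : M => TangentSpace 𝓘(ℝ, E) x))

/-- Each coefficient is the smooth metric evaluated on the push-forwards of two constant fields
under the inverse chart; these are smooth because the tangent map is. -/
lemma contDiffOn_chartMetric (x₀ : M) :
    ContDiffOn ℝ ∞ (chartMetric g.inner x₀) (extChartAt 𝓘(ℝ, E) x₀).target := by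
  have hopen : IsOpen (extChartAt 𝓘(ℝ, E) x₀).target := isOpen_extChartAt_target x₀
  have hσ : ContMDiffOn 𝓘(ℝ, E) 𝓘(ℝ, E) ∞ (extChartAt 𝓘(ℝ, E) x₀).symm
      (extChartAt 𝓘(ℝ, E) x₀).target := contMDiffOn_extChartAt_symm x₀
  have hvec (v : E) : ContMDiffOn 𝓘(ℝ, E) (𝓘(ℝ, E).prod 𝓘(ℝ, E)) ∞
      (fun y : E => (⟨(extChartAt 𝓘(ℝ, E) x₀).symm y,
        mfderiv 𝓘(ℝ, E) 𝓘(ℝ, E) (extChartAt 𝓘(ℝ, E) x₀).symm y v⟩ :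
          TangentBundle 𝓘(ℝ, E) M)) (extChartAt 𝓘(ℝ, E) x₀).target := by
    have h := hσ.contMDiffOn_tangentMapWithin (m := ∞) (by simp) hopen.uniqueMDiffOn
    have hc : ContMDiffOn 𝓘(ℝ, E) (𝓘(ℝ, E).prod 𝓘(ℝ, E)) ∞
        (fun y : E => (⟨y, v⟩ : TangentBundle 𝓘(ℝ, E) E)) (extChartAt 𝓘(ℝ, E) x₀).target := by
      apply ContMDiff.contMDiffOn
      intro y
      rw [Bundle.contMDiffAt_totalSpace]
      refine ⟨contMDiffAt_id, ?_⟩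
      simpa using contMDiffAt_const
    refine (h.comp hc fun y hy => hy).congr fun y hy => ?_
    simp only [Function.comp, tangentMapWithin]
    rw [mfderivWithin_of_isOpen hopen hy]
  rw [contDiffOn_clm_apply]
  intro v
  rw [contDiffOn_clm_apply]
  intro w
  rw [← contMDiffOn_iff_contDiffOn]
  have := ContMDiffOn.clm_bundle_apply₂ (F₁ := E) (F₂ := E) (F₃ := ℝ)
    (E₃ := Bundle.Trivial M ℝ) (g.contMDiff.comp_contMDiffOn hσ) (hvec v) (hvec w)
  intro y hy
  have h2 := this y hy
  rw [Bundle.contMDiffWithinAt_totalSpace] at h2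
  exact h2.2

lemma contDiffAt_chartMetric (x : M) :
    ContDiffAt ℝ ∞ (chartMetric g.inner x) (extChartAt 𝓘(ℝ, E) x x) :=
  (contDiffOn_chartMetric g x).contDiffAt (extChartAt_target_mem_nhds x)

lemma coordMetric_symm (x : M) (v w : E) :
    coordMetric g.inner x v w = coordMetric g.inner x w v := g.symm x v w

lemma coordMetric_pos (x : M) {v : E} (hv : v ≠ 0) : 0 < coordMetric g.inner x v v := g.pos x v hv

lemma fderiv_chartMetric_symm (x : M) (u v w : E) :
    fderiv ℝ (chartMetric g.inner x) (extChartAt 𝓘(ℝ, E) x x) u v w =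
      fderiv ℝ (chartMetric g.inner x) (extChartAt 𝓘(ℝ, E) x x) u w v := by
  have hd := ((contDiffAt_chartMetric g x).differentiableAt (by simp)).hasFDerivAt
  have h (a b : E) := (hd.clm_apply (hasFDerivAt_const a _)).clm_apply (hasFDerivAt_const b _)
  have h2 := (h v w).unique ((h w v).congr_of_eventuallyEq
    (Eventually.of_forall fun y => chartMetric_symm (coordMetric_symm g) x y v w))
  simpa using congrArg (fun L => L u) h2

end Smooth

/-! ### Christoffel symbols through the Koszul formula -/

section Christoffel

variable {E : Type*} [NormedAddCommGroup E] [NormedSpace ℝ E] [FiniteDimensional ℝ E]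

/-- A positive definite bilinear form on a finite-dimensional space is invertible as a map to the
dual. -/
lemma ContinuousLinearMap.isInvertible_of_pos {B : E →L[ℝ] E →L[ℝ] ℝ}
    (hB : ∀ v, v ≠ 0 → 0 < B v v) : B.IsInvertible := by
  have hinj : Function.Injective (B : E →ₗ[ℝ] E →L[ℝ] ℝ) := by
    rw [← LinearMap.ker_eq_bot, LinearMap.ker_eq_bot']
    intro v hv
    by_contra h
    have h1 := hB v h
    have h2 : B v = 0 := hv
    simp [h2] at h1
  have hfr : Module.finrank ℝ E = Module.finrank ℝ (E →L[ℝ] ℝ) := by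
    rw [← (LinearMap.toContinuousLinearMap (𝕜 := ℝ) (E := E) (F' := ℝ)).finrank_eq]
    exact (Subspace.dual_finrank_eq (K := ℝ) (V := E)).symm
  exact ⟨(LinearEquiv.ofInjectiveOfFinrankEq _ hinj hfr).toContinuousLinearEquiv, by ext; rfl⟩

/-- The Koszul formula determines `christoffel`. -/
lemma christoffel_eq_iff {H : Type*} [TopologicalSpace H] {I : ModelWithCorners ℝ E H}
    {M : Type*} [TopologicalSpace M] [ChartedSpace H M]
    {g : ∀ x : M, TangentSpace I x →L[ℝ] TangentSpace I x →L[ℝ] ℝ} {x : M}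
    (hinv : (chartMetric g x (extChartAt I x x)).IsInvertible) (v w u : E) :
    christoffel g x v w = u ↔ ∀ z, chartMetric g x (extChartAt I x x) u z =
      1 / 2 * (fderiv ℝ (chartMetric g x) (extChartAt I x x) v w z +
        fderiv ℝ (chartMetric g x) (extChartAt I x x) w v z -
        fderiv ℝ (chartMetric g x) (extChartAt I x x) z v w) := by
  obtain ⟨e, he⟩ := hinv
  have h : christoffel g x v w = e.symm ((1 / 2 : ℝ) •
      (fderiv ℝ (chartMetric g x) (extChartAt I x x) v w +
        fderiv ℝ (chartMetric g x) (extChartAt I x x) w v -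
        ((fderiv ℝ (chartMetric g x) (extChartAt I x x)).flip v).flip w)) := by
    simp only [christoffel]
    rw [← he, ContinuousLinearMap.inverse_equiv]
    rfl
  rw [h, ContinuousLinearEquiv.symm_apply_eq, ← he, eq_comm, ContinuousLinearMap.ext_iff]
  simp

variable {M : Type*} [TopologicalSpace M] [ChartedSpace E M] [IsManifold 𝓘(ℝ, E) ∞ M]
  (g : Bundle.ContMDiffRiemannianMetric 𝓘(ℝ, E) ∞ E (fun x : M => TangentSpace 𝓘(ℝ, E) x))

lemma isInvertible_chartMetric_self (x : M) :
    (chartMetric g.inner x (extChartAt 𝓘(ℝ, E) x x)).IsInvertible := by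
  rw [chartMetric_self]
  exact ContinuousLinearMap.isInvertible_of_pos fun v hv => coordMetric_pos g x hv

lemma coordMetric_christoffel (x : M) (v w z : E) :
    coordMetric g.inner x (christoffel g.inner x v w) z =
      1 / 2 * (fderiv ℝ (chartMetric g.inner x) (extChartAt 𝓘(ℝ, E) x x) v w z +
        fderiv ℝ (chartMetric g.inner x) (extChartAt 𝓘(ℝ, E) x x) w v z -
        fderiv ℝ (chartMetric g.inner x) (extChartAt 𝓘(ℝ, E) x x) z v w) := by
  rw [← chartMetric_self]
  exact (christoffel_eq_iff (isInvertible_chartMetric_self g x) v w _).1 rfl z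

/-- Metric compatibility, with the direction of differentiation `w` in the second slot of the
symbols. This is the form needed for `∇_v η`, whose Christoffel term has `η` in that slot. -/
lemma coordMetric_christoffel_add (x : M) (v w z : E) :
    coordMetric g.inner x (christoffel g.inner x v w) z +
      coordMetric g.inner x (christoffel g.inner x z w) v =
      fderiv ℝ (chartMetric g.inner x) (extChartAt 𝓘(ℝ, E) x x) w v z := by
  rw [coordMetric_christoffel, coordMetric_christoffel, fderiv_chartMetric_symm g x v w z,
    fderiv_chartMetric_symm g x z v w, fderiv_chartMetric_symm g x w z v]
  ring

set_option synthInstance.maxHeartbeats 200000 in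
-- The combination is the one met on the graph: tangent vector `df_s v + r η`, normal component `b
-- η`.
lemma christoffel_lincomb (x : M) (v w u : E) (r b : ℝ) :
    christoffel g.inner x (v + r • w) (b • u) =
      b • christoffel g.inner x v u + (b * r) • christoffel g.inner x w u := by
  rw [christoffel_eq_iff (isInvertible_chartMetric_self g x)]
  intro z
  rw [chartMetric_self]
  rw [map_add, map_smul, map_smul, add_apply, smul_apply, smul_apply, coordMetric_christoffel,
    coordMetric_christoffel]
  generalize fderiv ℝ (chartMetric g.inner x) (extChartAt 𝓘(ℝ, E) x x) = D
  simp only [map_add, map_smul, add_apply, smul_apply, smul_eq_mul]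
  ring

end Christoffel

/-! ### The product metric on `M × ℝ` -/

section Product

variable {E : Type*} [NormedAddCommGroup E] [NormedSpace ℝ E]
  {M : Type*} [TopologicalSpace M] [ChartedSpace E M]

lemma coordMetric_prodMetric
    (g : ∀ x : M, TangentSpace 𝓘(ℝ, E) x →L[ℝ] TangentSpace 𝓘(ℝ, E) x →L[ℝ] ℝ) (x : M × ℝ)
    (v w : E × ℝ) :
    coordMetric (prodMetric g) x v w = coordMetric g x.1 v.1 w.1 + v.2 * w.2 := rfl

lemma coordDeriv_extChartAt_prod_symm [IsManifold 𝓘(ℝ, E) ∞ M] (x : M × ℝ) {y : E × ℝ}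
    (hy : y.1 ∈ (extChartAt 𝓘(ℝ, E) x.1).target) (v : E × ℝ) :
    coordDeriv 𝓘(ℝ, E × ℝ) (𝓘(ℝ, E).prod 𝓘(ℝ, ℝ))
      (extChartAt (𝓘(ℝ, E).prod 𝓘(ℝ, ℝ)) x).symm y v =
      (coordDeriv 𝓘(ℝ, E) 𝓘(ℝ, E) (extChartAt 𝓘(ℝ, E) x.1).symm y.1 v.1, v.2) := by
  have : IsManifold 𝓘(ℝ, E) 1 M := .of_le (n := ∞) (by simp)
  have hσ : MDifferentiableAt 𝓘(ℝ, E) 𝓘(ℝ, E) (extChartAt 𝓘(ℝ, E) x.1).symm y.1 := by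
    have := mdifferentiableWithinAt_extChartAt_symm (I := 𝓘(ℝ, E)) hy
    rwa [modelWithCornersSelf_coe, range_id, mdifferentiableWithinAt_univ] at this
  have h1 : HasMFDerivAt 𝓘(ℝ, E × ℝ) 𝓘(ℝ, E) (Prod.fst : E × ℝ → E) y
    (ContinuousLinearMap.fst ℝ E ℝ) := hasFDerivAt_fst.hasMFDerivAt
  have h2 : HasMFDerivAt 𝓘(ℝ, E × ℝ) 𝓘(ℝ, ℝ) (Prod.snd : E × ℝ → ℝ) y
    (ContinuousLinearMap.snd ℝ E ℝ) := hasFDerivAt_snd.hasMFDerivAt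
  have h3 := (hσ.hasMFDerivAt.comp y h1).prodMk h2
  have h4 : ((extChartAt (𝓘(ℝ, E).prod 𝓘(ℝ, ℝ)) x).symm : E × ℝ → M × ℝ) =
      fun z => ((extChartAt 𝓘(ℝ, E) x.1).symm z.1, z.2) := by
    rw [extChartAt_prod]
    rfl
  have h5 := h3.mfderiv
  rw [coordDeriv, h4]
  exact congrArg (fun L => L v) h5

lemma chartMetric_prodMetric [IsManifold 𝓘(ℝ, E) ∞ M]
    (g : ∀ x : M, TangentSpace 𝓘(ℝ, E) x →L[ℝ] TangentSpace 𝓘(ℝ, E) x →L[ℝ] ℝ) (x : M × ℝ)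
    {y : E × ℝ} (hy : y.1 ∈ (extChartAt 𝓘(ℝ, E) x.1).target) (v w : E × ℝ) :
    chartMetric (prodMetric g) x y v w = chartMetric g x.1 y.1 v.1 w.1 + v.2 * w.2 := by
  have h : chartMetric (prodMetric g) x y v w = coordMetric (prodMetric g)
      ((extChartAt (𝓘(ℝ, E).prod 𝓘(ℝ, ℝ)) x).symm y)
      (coordDeriv 𝓘(ℝ, E × ℝ) (𝓘(ℝ, E).prod 𝓘(ℝ, ℝ))
        (extChartAt (𝓘(ℝ, E).prod 𝓘(ℝ, ℝ)) x).symm y v)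
      (coordDeriv 𝓘(ℝ, E × ℝ) (𝓘(ℝ, E).prod 𝓘(ℝ, ℝ))
        (extChartAt (𝓘(ℝ, E).prod 𝓘(ℝ, ℝ)) x).symm y w) := rfl
  rw [h, coordDeriv_extChartAt_prod_symm x hy, coordDeriv_extChartAt_prod_symm x hy,
    coordMetric_prodMetric, chartMetric_apply,
    extChartAt_prod]
  rfl

lemma extChartAt_prod_self (x : M × ℝ) :
    extChartAt (𝓘(ℝ, E).prod 𝓘(ℝ, ℝ)) x x = (extChartAt 𝓘(ℝ, E) x.1 x.1, x.2) := by
  rw [extChartAt_prod]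
  rfl

variable [IsManifold 𝓘(ℝ, E) ∞ M] [FiniteDimensional ℝ E]
  (g : Bundle.ContMDiffRiemannianMetric 𝓘(ℝ, E) ∞ E (fun x : M => TangentSpace 𝓘(ℝ, E) x))

set_option synthInstance.maxHeartbeats 200000 in
lemma fderiv_chartMetric_prodMetric (x : M × ℝ) (u v w : E × ℝ) :
    fderiv ℝ (chartMetric (prodMetric g.inner) x) (extChartAt (𝓘(ℝ, E).prod 𝓘(ℝ, ℝ)) x x) u v w =
      fderiv ℝ (chartMetric g.inner x.1) (extChartAt 𝓘(ℝ, E) x.1 x.1) u.1 v.1 w.1 := by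
  rw [extChartAt_prod_self]
  set z : E × ℝ := (extChartAt 𝓘(ℝ, E) x.1 x.1, x.2)
  set U : Set (E × ℝ) := Prod.fst ⁻¹' (extChartAt 𝓘(ℝ, E) x.1).target
  have hU : U ∈ 𝓝 z := (continuous_fst.isOpen_preimage _ (isOpen_extChartAt_target x.1)).mem_nhds
    (mem_extChartAt_target x.1)
  -- Evaluating the derivative on fixed vectors requires differentiability of the operator-valued
  -- map itself, since otherwise `fderiv` takes the default value zero.
  have hd : DifferentiableAt ℝ (chartMetric (prodMetric g.inner) x) z := by
    have : ContDiffOn ℝ ∞ (chartMetric (prodMetric g.inner) x) U := by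
      rw [contDiffOn_clm_apply]
      intro v
      rw [contDiffOn_clm_apply]
      intro w
      refine ContDiffOn.congr ?_ fun y hy => chartMetric_prodMetric g.inner x hy v w
      exact ((((contDiffOn_chartMetric g x.1).comp contDiffOn_fst fun y hy => hy).clm_apply
        contDiffOn_const).clm_apply contDiffOn_const).add contDiffOn_const
    exact (this.contDiffAt hU).differentiableAt (by simp)
  have h1 := (hd.hasFDerivAt.clm_apply (hasFDerivAt_const v _)).clm_apply (hasFDerivAt_const w _)
  have hd2 := ((contDiffAt_chartMetric g x.1).differentiableAt (by simp)).hasFDerivAt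
  have h2 := ((HasFDerivAt.comp z (f := Prod.fst) hd2 hasFDerivAt_fst).clm_apply
    (hasFDerivAt_const v.1 _)).clm_apply (hasFDerivAt_const w.1 _)
  have h3 := h1.unique ((h2.add_const (v.2 * w.2)).congr_of_eventuallyEq
    (Filter.eventually_of_mem hU fun y hy => chartMetric_prodMetric g.inner x hy v w))
  simpa using congrArg (fun L => L u) h3

/-- The `dt²` block of the metric is constant, so the Koszul formula sees only derivatives of the
metric of `M`. -/
lemma christoffel_prodMetric (x : M × ℝ) (v w : E × ℝ) :
    christoffel (prodMetric g.inner) x v w = (christoffel g.inner x.1 v.1 w.1, 0) := by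
  have hself (u z : E × ℝ) : chartMetric (prodMetric g.inner) x
      (extChartAt (𝓘(ℝ, E).prod 𝓘(ℝ, ℝ)) x x) u z =
        coordMetric g.inner x.1 u.1 z.1 + u.2 * z.2 := by
    rw [extChartAt_prod_self, chartMetric_prodMetric _ _ (mem_extChartAt_target x.1),
      chartMetric_self]
  rw [christoffel_eq_iff]
  · intro z
    rw [hself]
    simp only [fderiv_chartMetric_prodMetric, coordMetric_christoffel, zero_mul, add_zero]
  · refine ContinuousLinearMap.isInvertible_of_pos fun v hv => ?_
    rw [hself]
    by_cases h : v.1 = 0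
    · have h2 : v.2 ≠ 0 := fun h2 => hv (Prod.ext h h2)
      rw [h, map_zero, zero_add]
      exact mul_self_pos.2 h2
    · have := coordMetric_pos g x.1 h
      nlinarith [mul_self_nonneg v.2]

end Product

/-! ### Derivatives along maps computed in charts -/

section Coordinates

variable {E : Type*} [NormedAddCommGroup E] [NormedSpace ℝ E]
  {H : Type*} [TopologicalSpace H] {I : ModelWithCorners ℝ E H}
  {M : Type*} [TopologicalSpace M] [ChartedSpace H M]
  {E' : Type*} [NormedAddCommGroup E'] [NormedSpace ℝ E']
  {H' : Type*} [TopologicalSpace H'] {I' : ModelWithCorners ℝ E' H'}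
  {S : Type*} [TopologicalSpace S] [ChartedSpace H' S] [IsManifold I' 1 S]

lemma hasMFDerivAt_comp_extChartAt {F : Type*} [NormedAddCommGroup F] [NormedSpace ℝ F]
    {G : S → F} {Ψ : E' → F} {L : E' →L[ℝ] F} {p : S} (hL : HasFDerivAt Ψ L (extChartAt I' p p))
    (hG : ∀ᶠ q in 𝓝 p, G q = Ψ (extChartAt I' p q)) :
    HasMFDerivAt I' 𝓘(ℝ, F) G p L := by
  have h1 := (mdifferentiableAt_extChartAt (I := I') (mem_chart_source H' p)).hasMFDerivAt
  have h2 := HasMFDerivAt.comp p hL.hasMFDerivAt h1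
  rw [mfderiv_extChartAt_self] at h2
  exact h2.congr_of_eventuallyEq hG

/-- Reduces a covariant derivative to the ordinary derivative of a coordinate expression `Ψ` of the
field: the chart of `S` at `p` has identity derivative there, so `L` needs no correction. -/
lemma covDerivAlong_eq (g : ∀ x : M, TangentSpace I x →L[ℝ] TangentSpace I x →L[ℝ] ℝ)
    {F : S → M} {N : S → E} {Ψ : E' → E} {L : E' →L[ℝ] E} {p : S}
    (hL : HasFDerivAt Ψ L (extChartAt I' p p))
    (hN : ∀ᶠ q in 𝓝 p, coordDeriv I 𝓘(ℝ, E) (extChartAt I (F p)) (F q) (N q) =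
      Ψ (extChartAt I' p q)) (X : E') :
    (covDerivAlong (I' := I') g F N p X : E) =
      L X + christoffel g (F p) (coordDeriv I' I F p X) (N p) := by
  have h := (hasMFDerivAt_comp_extChartAt hL hN).mfderiv
  have h2 := congrArg (fun A : E' →L[ℝ] E => A X) h
  exact congrArg (· + christoffel g (F p) (coordDeriv I' I F p X) (N p)) h2

lemma coordDeriv_extChartAt_coordDeriv [IsManifold I 1 M] {F : S → M} {Ψ : E' → E}
    {L : E' →L[ℝ] E} {p : S} {x₀ : M} (hF : MDifferentiableAt I' I F p)
    (hp : F p ∈ (chartAt H x₀).source) (hL : HasFDerivAt Ψ L (extChartAt I' p p))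
    (h : ∀ᶠ q in 𝓝 p, extChartAt I x₀ (F q) = Ψ (extChartAt I' p q)) (v : E') :
    coordDeriv I 𝓘(ℝ, E) (extChartAt I x₀) (F p) (coordDeriv I' I F p v) = L v := by
  have h1 := hasMFDerivAt_comp_extChartAt (G := extChartAt I x₀ ∘ F) hL h
  have h2 := HasMFDerivAt.comp p (mdifferentiableAt_extChartAt (I := I) hp).hasMFDerivAt
    hF.hasMFDerivAt
  exact congrArg (fun A : E' →L[ℝ] E => A v) (hasMFDerivAt_unique h2 h1)

end Coordinates

/-! ### The family of hypersurfaces and its normal field in charts -/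

section Family

variable {E : Type*} [NormedAddCommGroup E] [NormedSpace ℝ E]
  {M : Type*} [TopologicalSpace M] [ChartedSpace E M]
  {E' : Type*} [NormedAddCommGroup E'] [NormedSpace ℝ E']
  {S : Type*} [TopologicalSpace S] [ChartedSpace E' S]

/-- The family `f`, near `(p₀, s₀)`, in the preferred charts at `p₀` and `f s₀ p₀`. -/
def familyChart (f : ℝ → S → M) (p₀ : S) (s₀ : ℝ) (z : E' × ℝ) : E :=
  extChartAt 𝓘(ℝ, E) (f s₀ p₀) (f z.2 ((extChartAt 𝓘(ℝ, E') p₀).symm z.1))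

/-- The point of `E' × ℝ` which represents `(p₀, s₀)`. -/
def familyPoint (E' : Type*) [NormedAddCommGroup E'] [NormedSpace ℝ E']
    {S : Type*} [TopologicalSpace S] [ChartedSpace E' S] (p₀ : S) (s₀ : ℝ) : E' × ℝ :=
  (extChartAt 𝓘(ℝ, E') p₀ p₀, s₀)

/-- The normal `η_s(p)` as a vector of the model space. -/
def coordNormal (f : ℝ → S → M) (s : ℝ) (p : S) : E := familyNormal 𝓘(ℝ, E) f s p

variable [IsManifold 𝓘(ℝ, E) ∞ M] [IsManifold 𝓘(ℝ, E') ∞ S] {f : ℝ → S → M} {J : Set ℝ}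
  (hJ : IsOpen J)
  (hf : ContMDiffOn (𝓘(ℝ, E').prod 𝓘(ℝ, ℝ)) 𝓘(ℝ, E) ∞ (fun x : S × ℝ => f x.2 x.1) (univ ×ˢ J))
include hJ hf

omit [IsManifold 𝓘(ℝ, E) ∞ M] [IsManifold 𝓘(ℝ, E') ∞ S] in
lemma contMDiffAt_family {s : ℝ} (hs : s ∈ J) (p : S) :
    ContMDiffAt (𝓘(ℝ, E').prod 𝓘(ℝ, ℝ)) 𝓘(ℝ, E) ∞ (fun x : S × ℝ => f x.2 x.1) (p, s) :=
  hf.contMDiffAt ((isOpen_univ.prod hJ).mem_nhds ⟨mem_univ _, hs⟩)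

omit [IsManifold 𝓘(ℝ, E) ∞ M] [IsManifold 𝓘(ℝ, E') ∞ S] in
lemma contMDiffAt_family_left {s : ℝ} (hs : s ∈ J) (p : S) :
    ContMDiffAt 𝓘(ℝ, E') 𝓘(ℝ, E) ∞ (f s) p :=
  ContMDiffAt.comp p (g := fun x : S × ℝ => f x.2 x.1) (f := fun q => (q, s))
    (contMDiffAt_family hJ hf hs p) (contMDiffAt_id.prodMk contMDiffAt_const)

omit [IsManifold 𝓘(ℝ, E) ∞ M] [IsManifold 𝓘(ℝ, E') ∞ S] in
lemma contMDiffAt_family_right {s : ℝ} (hs : s ∈ J) (p : S) :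
    ContMDiffAt 𝓘(ℝ, ℝ) 𝓘(ℝ, E) ∞ (fun r => f r p) s :=
  ContMDiffAt.comp s (g := fun x : S × ℝ => f x.2 x.1) (f := fun r => (p, r))
    (contMDiffAt_family hJ hf hs p) (contMDiffAt_const.prodMk contMDiffAt_id)

variable {s₀ : ℝ} (hs : s₀ ∈ J) (p₀ : S)
include hs

omit [IsManifold 𝓘(ℝ, E) ∞ M] in
lemma contDiffAt_familyChart :
    ContDiffAt ℝ ∞ (familyChart (E := E) f p₀ s₀) (familyPoint E' p₀ s₀) := by
  rw [← contMDiffAt_iff_contDiffAt]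
  have h1 : ContMDiffAt 𝓘(ℝ, E' × ℝ) 𝓘(ℝ, E') ∞
      (fun z : E' × ℝ => (extChartAt 𝓘(ℝ, E') p₀).symm z.1) (familyPoint E' p₀ s₀) := by
    refine ContMDiffAt.comp (familyPoint E' p₀ s₀) (g := (extChartAt 𝓘(ℝ, E') p₀).symm)
      ?_ contDiff_fst.contMDiff.contMDiffAt
    exact (contMDiffOn_extChartAt_symm (I := 𝓘(ℝ, E')) p₀).contMDiffAt
      (extChartAt_target_mem_nhds (I := 𝓘(ℝ, E')) p₀)
  have h2 : ContMDiffAt 𝓘(ℝ, E' × ℝ) 𝓘(ℝ, ℝ) ∞ (fun z : E' × ℝ => z.2) (familyPoint E' p₀ s₀) :=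
    contDiff_snd.contMDiff.contMDiffAt
  have h3 := (contMDiffAt_family hJ hf hs p₀).comp_of_eq (h1.prodMk h2)
    (by simp [familyPoint])
  exact (contMDiffAt_extChartAt (I := 𝓘(ℝ, E)) (x := f s₀ p₀)).comp_of_eq h3
    (by simp [familyPoint])

omit [IsManifold 𝓘(ℝ, E) ∞ M] [IsManifold 𝓘(ℝ, E') ∞ S] in
lemma eventually_mem_source :
    ∀ᶠ x : S × ℝ in 𝓝 (p₀, s₀), x.2 ∈ J ∧ x.1 ∈ (extChartAt 𝓘(ℝ, E') p₀).source ∧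
      f x.2 x.1 ∈ (extChartAt 𝓘(ℝ, E) (f s₀ p₀)).source := by
  refine (continuousAt_snd.eventually_mem (hJ.mem_nhds hs)).and
    ((continuousAt_fst.eventually_mem (extChartAt_source_mem_nhds p₀)).and ?_)
  exact (contMDiffAt_family hJ hf hs p₀).continuousAt.eventually_mem
    (extChartAt_source_mem_nhds (f s₀ p₀))

omit [IsManifold 𝓘(ℝ, E) ∞ M] in
lemma eventually_differentiableAt_familyChart :
    ∀ᶠ x : S × ℝ in 𝓝 (p₀, s₀),
      DifferentiableAt ℝ (familyChart (E := E) f p₀ s₀) (extChartAt 𝓘(ℝ, E') p₀ x.1, x.2) := by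
  have h1 := ((contDiffAt_familyChart hJ hf hs p₀).of_le (m := 1) (by simp)).eventually (by simp)
  have hc : ContinuousAt (fun x : S × ℝ => (extChartAt 𝓘(ℝ, E') p₀ x.1, x.2)) (p₀, s₀) :=
    (ContinuousAt.comp (f := Prod.fst) (x := (p₀, s₀)) (continuousAt_extChartAt p₀)
      continuousAt_fst).prodMk continuousAt_snd
  exact (hc.eventually h1).mono fun x hx => hx.differentiableAt (by simp)

omit [IsManifold 𝓘(ℝ, E) ∞ M] [IsManifold 𝓘(ℝ, E') ∞ S] hJ hf hs in
lemma familyChart_extChartAt {q : S} (hq : q ∈ (extChartAt 𝓘(ℝ, E') p₀).source) (s : ℝ) :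
    familyChart f p₀ s₀ (extChartAt 𝓘(ℝ, E') p₀ q, s) = extChartAt 𝓘(ℝ, E) (f s₀ p₀) (f s q) := by
  rw [familyChart, (extChartAt 𝓘(ℝ, E') p₀).left_inv hq]

/-- The derivative of `f s` at `p₀` in the charts. -/
lemma eventually_coordDeriv_extChartAt_family :
    ∀ᶠ s in 𝓝 s₀, ∀ v : E',
      coordDeriv 𝓘(ℝ, E) 𝓘(ℝ, E) (extChartAt 𝓘(ℝ, E) (f s₀ p₀)) (f s p₀)
        (coordDeriv 𝓘(ℝ, E') 𝓘(ℝ, E) (f s) p₀ v) =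
      fderiv ℝ (familyChart f p₀ s₀) (extChartAt 𝓘(ℝ, E') p₀ p₀, s) (v, 0) := by
  have : IsManifold 𝓘(ℝ, E) 1 M := .of_le (n := ∞) (by simp)
  have : IsManifold 𝓘(ℝ, E') 1 S := .of_le (n := ∞) (by simp)
  have hc : ContinuousAt (fun s : ℝ => (p₀, s)) s₀ := by fun_prop
  filter_upwards [hc.eventually (eventually_mem_source hJ hf hs p₀),
    hc.eventually (eventually_differentiableAt_familyChart hJ hf hs p₀)] with s h1 h2 v
  have hL := HasFDerivAt.comp (extChartAt 𝓘(ℝ, E') p₀ p₀) (f := fun e : E' => (e, s)) h2.hasFDerivAt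
    (hasFDerivAt_prodMk_left _ s)
  rw [coordDeriv_extChartAt_coordDeriv ((contMDiffAt_family_left hJ hf h1.1 p₀).mdifferentiableAt
    (by simp)) (by simpa using h1.2.2) hL]
  · rfl
  · filter_upwards [extChartAt_source_mem_nhds (I := 𝓘(ℝ, E')) p₀] with q hq
    exact (familyChart_extChartAt p₀ hq s).symm

/-- The normal field in the charts. -/
lemma eventually_coordDeriv_extChartAt_coordNormal :
    ∀ᶠ x : S × ℝ in 𝓝 (p₀, s₀),
      coordDeriv 𝓘(ℝ, E) 𝓘(ℝ, E) (extChartAt 𝓘(ℝ, E) (f s₀ p₀)) (f x.2 x.1)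
        (coordNormal f x.2 x.1) =
      fderiv ℝ (familyChart f p₀ s₀) (extChartAt 𝓘(ℝ, E') p₀ x.1, x.2) (0, 1) := by
  have : IsManifold 𝓘(ℝ, E) 1 M := .of_le (n := ∞) (by simp)
  filter_upwards [eventually_mem_source hJ hf hs p₀,
    eventually_differentiableAt_familyChart hJ hf hs p₀] with x h1 h2
  have hL := h2.hasFDerivAt.comp x.2 (hasFDerivAt_prodMk_right (extChartAt 𝓘(ℝ, E') p₀ x.1) x.2)
  have h3 := coordDeriv_extChartAt_coordDeriv (x₀ := f s₀ p₀) (I' := 𝓘(ℝ, ℝ))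
    ((contMDiffAt_family_right hJ hf h1.1 x.1).mdifferentiableAt (by simp))
    (by simpa using h1.2.2) hL
    (Eventually.of_forall fun r => (familyChart_extChartAt p₀ h1.2.1 r).symm) 1
  exact h3

lemma coordDeriv_family (v : E') :
    coordDeriv 𝓘(ℝ, E') 𝓘(ℝ, E) (f s₀) p₀ v =
      fderiv ℝ (familyChart f p₀ s₀) (familyPoint E' p₀ s₀) (v, 0) := by
  have : IsManifold 𝓘(ℝ, E) 1 M := .of_le (n := ∞) (by simp)
  have h := (eventually_coordDeriv_extChartAt_family hJ hf hs p₀).self_of_nhds v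
  rwa [coordDeriv_extChartAt_self] at h

lemma coordNormal_eq :
    coordNormal f s₀ p₀ =
      fderiv ℝ (familyChart (E := E) f p₀ s₀) (familyPoint E' p₀ s₀) (0, 1) := by
  have : IsManifold 𝓘(ℝ, E) 1 M := .of_le (n := ∞) (by simp)
  have h := (eventually_coordDeriv_extChartAt_coordNormal hJ hf hs p₀).self_of_nhds
  rwa [coordDeriv_extChartAt_self] at h

omit [IsManifold 𝓘(ℝ, E) ∞ M] [IsManifold 𝓘(ℝ, E') ∞ S] in
lemma coordDeriv_family_prod (w : E' × ℝ) :
    coordDeriv (𝓘(ℝ, E').prod 𝓘(ℝ, ℝ)) 𝓘(ℝ, E) (fun x : S × ℝ => f x.2 x.1) (p₀, s₀) w =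
      coordDeriv 𝓘(ℝ, E') 𝓘(ℝ, E) (f s₀) p₀ w.1 + w.2 • coordNormal f s₀ p₀ := by
  have h := mfderiv_prod_eq_add_apply (v := w)
    ((contMDiffAt_family hJ hf hs p₀).mdifferentiableAt (by simp))
  have h2 (A : ℝ →L[ℝ] E) : A w.2 = w.2 • A 1 := by rw [← map_smul, smul_eq_mul, mul_one]
  exact h.trans (congrArg (coordDeriv 𝓘(ℝ, E') 𝓘(ℝ, E) (f s₀) p₀ w.1 + ·)
    (h2 (coordDeriv 𝓘(ℝ, ℝ) 𝓘(ℝ, E) (fun r => f r p₀) s₀)))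

end Family

/-! ### Charts of the product manifold -/

section Product

variable {E : Type*} [NormedAddCommGroup E] [NormedSpace ℝ E]
  {M : Type*} [TopologicalSpace M] [ChartedSpace E M]

lemma coordDeriv_extChartAt_prod [IsManifold 𝓘(ℝ, E) 1 M] (x y : M × ℝ)
    (hy : y.1 ∈ (chartAt E x.1).source) (v : E × ℝ) :
    coordDeriv (𝓘(ℝ, E).prod 𝓘(ℝ, ℝ)) 𝓘(ℝ, E × ℝ)
      (extChartAt (𝓘(ℝ, E).prod 𝓘(ℝ, ℝ)) x) y v =
      (coordDeriv 𝓘(ℝ, E) 𝓘(ℝ, E) (extChartAt 𝓘(ℝ, E) x.1) y.1 v.1, v.2) := by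
  have h1 := HasMFDerivAt.comp y (mdifferentiableAt_extChartAt (I := 𝓘(ℝ, E)) hy).hasMFDerivAt
    (hasMFDerivAt_fst (I := 𝓘(ℝ, E)) (I' := 𝓘(ℝ, ℝ)) (x := y))
  have h3 : HasMFDerivAt (𝓘(ℝ, E).prod 𝓘(ℝ, ℝ)) 𝓘(ℝ, E × ℝ)
    (fun z : M × ℝ => (extChartAt 𝓘(ℝ, E) x.1 z.1, z.2)) y
    (((coordDeriv 𝓘(ℝ, E) 𝓘(ℝ, E) (extChartAt 𝓘(ℝ, E) x.1) y.1).comp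
      (ContinuousLinearMap.fst ℝ E ℝ)).prod (ContinuousLinearMap.snd ℝ E ℝ) :
        E × ℝ →L[ℝ] E × ℝ) := by
    have h2 := hasMFDerivAt_snd (I := 𝓘(ℝ, E)) (I' := 𝓘(ℝ, ℝ)) (x := y)
    exact ⟨h1.1.prodMk h2.1, h1.2.prodMk h2.2⟩
  have h4 : (extChartAt (𝓘(ℝ, E).prod 𝓘(ℝ, ℝ)) x : M × ℝ → E × ℝ) =
      fun z => (extChartAt 𝓘(ℝ, E) x.1 z.1, z.2) := by
    rw [extChartAt_prod]
    rfl
  rw [coordDeriv, h4]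
  exact congrArg (fun L : E × ℝ →L[ℝ] E × ℝ => L v) h3.mfderiv

end Product

/-! ### The functions `ρ` and `θ` attached to the slope of the graph -/

section Slope

/-- The function `a' / √(1 + a'²)`, i.e. `a' θ`. -/
def graphSin (a : ℝ → ℝ) (s : ℝ) : ℝ := deriv a s / √(1 + deriv a s ^ 2)

/-- The function `1 / √(1 + a'²)`, i.e. `θ`. -/
def graphCos (a : ℝ → ℝ) (s : ℝ) : ℝ := 1 / √(1 + deriv a s ^ 2)

lemma graphCos_pos (a : ℝ → ℝ) (s : ℝ) : 0 < graphCos a s := by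
  unfold graphCos; positivity

lemma graphSin_eq (a : ℝ → ℝ) (s : ℝ) : graphSin a s = deriv a s * graphCos a s := by
  unfold graphSin graphCos; ring

lemma graphSin_sq_add_graphCos_sq (a : ℝ → ℝ) (s : ℝ) :
    graphSin a s ^ 2 + graphCos a s ^ 2 = 1 := by
  have h : (0 : ℝ) < 1 + deriv a s ^ 2 := by positivity
  rw [graphSin, graphCos, div_pow, div_pow, Real.sq_sqrt h.le]
  field_simp
  ring

variable {a : ℝ → ℝ} {J : Set ℝ} {s : ℝ}

lemma contDiffOn_deriv (hJ : IsOpen J) (ha : ContDiffOn ℝ ∞ a J) :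
    ContDiffOn ℝ ∞ (deriv a) J :=
  ((contDiffOn_infty_iff_deriv_of_isOpen hJ).1 ha).2

lemma contDiffOn_graphCos (hJ : IsOpen J) (ha : ContDiffOn ℝ ∞ a J) :
    ContDiffOn ℝ ∞ (graphCos a) J := by
  have h (t : ℝ) : (0 : ℝ) < 1 + deriv a t ^ 2 := by positivity
  exact contDiffOn_const.div ((contDiffOn_const.add ((contDiffOn_deriv hJ ha).pow 2)).sqrt
    fun t _ => (h t).ne') fun t _ => (Real.sqrt_pos.2 (h t)).ne'

lemma contDiffOn_graphSin (hJ : IsOpen J) (ha : ContDiffOn ℝ ∞ a J) :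
    ContDiffOn ℝ ∞ (graphSin a) J :=
  ((contDiffOn_deriv hJ ha).mul (contDiffOn_graphCos hJ ha)).congr fun t _ => graphSin_eq a t

lemma hasDerivAt_graphSin (hJ : IsOpen J) (ha : ContDiffOn ℝ ∞ a J) (hs : s ∈ J) :
    HasDerivAt (graphSin a) (deriv (graphSin a) s) s :=
  (((contDiffOn_graphSin hJ ha).contDiffAt (hJ.mem_nhds hs)).differentiableAt (by simp)).hasDerivAt

/-- Differentiate `ρ² + θ² = 1`, substitute `ρ = a' θ` and cancel `θ > 0`. -/
lemma hasDerivAt_graphCos (hJ : IsOpen J) (ha : ContDiffOn ℝ ∞ a J) (hs : s ∈ J) :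
    HasDerivAt (graphCos a) (-(deriv a s * deriv (graphSin a) s)) s := by
  have h := (((contDiffOn_graphCos hJ ha).contDiffAt (hJ.mem_nhds hs)).differentiableAt
    (by simp)).hasDerivAt
  have h2 := ((hasDerivAt_graphSin hJ ha hs).pow 2).add (h.pow 2)
  have h3 := h2.unique ((hasDerivAt_const s (1 : ℝ)).congr_of_eventuallyEq
    (Eventually.of_forall fun t => graphSin_sq_add_graphCos_sq a t))
  have hc := graphCos_pos a s
  rw [graphSin_eq] at h3
  have h4 : graphCos a s * (deriv a s * deriv (graphSin a) s + deriv (graphCos a) s) = 0 := by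
    norm_num at h3
    linarith
  have h5 := (mul_eq_zero.1 h4).resolve_left hc.ne'
  rwa [neg_eq_of_add_eq_zero_right h5]

end Slope

/-! ### Covariant derivatives of `η` and of the graph normal -/

section Derivatives

variable {E : Type*} [NormedAddCommGroup E] [NormedSpace ℝ E] [FiniteDimensional ℝ E]
  {M : Type*} [TopologicalSpace M] [ChartedSpace E M] [IsManifold 𝓘(ℝ, E) ∞ M]
  {E' : Type*} [NormedAddCommGroup E'] [NormedSpace ℝ E']
  {S : Type*} [TopologicalSpace S] [ChartedSpace E' S] [IsManifold 𝓘(ℝ, E') ∞ S]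
  (g : Bundle.ContMDiffRiemannianMetric 𝓘(ℝ, E) ∞ E (fun x : M => TangentSpace 𝓘(ℝ, E) x))
  {f : ℝ → S → M} {J : Set ℝ} (hJ : IsOpen J)
  (hf : ContMDiffOn (𝓘(ℝ, E').prod 𝓘(ℝ, ℝ)) 𝓘(ℝ, E) ∞ (fun x : S × ℝ => f x.2 x.1) (univ ×ˢ J))

/-- The covariant derivative `∇_v η_s` at `p`, as a vector of the model space. -/
def normalCovDeriv (g : Bundle.ContMDiffRiemannianMetric 𝓘(ℝ, E) ∞ E
    (fun x : M => TangentSpace 𝓘(ℝ, E) x)) (f : ℝ → S → M) (s : ℝ) (p : S) (v : E') : E :=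
  covDerivAlong (I' := 𝓘(ℝ, E')) g.inner (f s) (familyNormal 𝓘(ℝ, E) f s) p v

/-- The covariant derivative `∇_s η_s` at `p`, as a vector of the model space. -/
def normalAcceleration (g : Bundle.ContMDiffRiemannianMetric 𝓘(ℝ, E) ∞ E
    (fun x : M => TangentSpace 𝓘(ℝ, E) x)) (f : ℝ → S → M) (s : ℝ) (p : S) : E :=
  covDerivAlong (I' := 𝓘(ℝ, ℝ)) g.inner (fun r => f r p) (velocity 𝓘(ℝ, E) (fun r => f r p)) s
    (1 : ℝ)

/-- The derivative of the normal field in the charts. -/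
def familyChartSecond (f : ℝ → S → M) (p₀ : S) (s₀ : ℝ) : E' × ℝ →L[ℝ] E :=
  fderiv ℝ (fun z => fderiv ℝ (familyChart f p₀ s₀) z (0, 1)) (familyPoint E' p₀ s₀)

/-- The normal of the graph, as a vector of the model space. -/
def coordGraphNormal (f : ℝ → S → M) (a : ℝ → ℝ) (x : S × ℝ) : E × ℝ :=
  graphNormal 𝓘(ℝ, E) f a x

omit [FiniteDimensional ℝ E] [IsManifold 𝓘(ℝ, E) ∞ M] [IsManifold 𝓘(ℝ, E') ∞ S]
  [NormedAddCommGroup E'] [NormedSpace ℝ E'] [TopologicalSpace S] [ChartedSpace E' S] in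
lemma coordGraphNormal_eq (f : ℝ → S → M) (a : ℝ → ℝ) (x : S × ℝ) :
    coordGraphNormal f a x =
      ((-graphSin a x.2) • coordNormal (E := E) f x.2 x.1, graphCos a x.2) := by
  rw [graphSin, ← neg_div]
  rfl

/-- The covariant derivative `∇_w N` of the normal of the graph, as a vector of the model space. -/
def graphNormalCovDeriv (g : Bundle.ContMDiffRiemannianMetric 𝓘(ℝ, E) ∞ E
    (fun x : M => TangentSpace 𝓘(ℝ, E) x)) (f : ℝ → S → M) (a : ℝ → ℝ) (x : S × ℝ)
    (w : E' × ℝ) : E × ℝ :=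
  covDerivAlong (I' := 𝓘(ℝ, E').prod 𝓘(ℝ, ℝ)) (prodMetric g.inner) (graphMap f a)
    (graphNormal 𝓘(ℝ, E) f a) x w

variable {s₀ : ℝ} (hs : s₀ ∈ J) (p₀ : S)
include hJ hf hs

omit [FiniteDimensional ℝ E] [IsManifold 𝓘(ℝ, E) ∞ M] in
lemma hasFDerivAt_fderiv_familyChart (w : E' × ℝ) :
    HasFDerivAt (fun z => fderiv ℝ (familyChart (E := E) f p₀ s₀) z w)
      (fderiv ℝ (fun z => fderiv ℝ (familyChart f p₀ s₀) z w) (familyPoint E' p₀ s₀))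
      (familyPoint E' p₀ s₀) :=
  ((((contDiffAt_familyChart hJ hf hs p₀).fderiv_right (m := 1) (by
    simpa [one_add_one_eq_two] using ENat.LEInfty.out)).differentiableAt (by simp)).clm_apply (differentiableAt_const w)).hasFDerivAt

/-- In the charts `η` is the `s`-derivative of `familyChart`, so its derivative along `v` is a mixed
second derivative. -/
lemma normalCovDeriv_eq (v : E') :
    normalCovDeriv g f s₀ p₀ v = familyChartSecond f p₀ s₀ (v, 0) +
      christoffel g.inner (f s₀ p₀) (coordDeriv 𝓘(ℝ, E') 𝓘(ℝ, E) (f s₀) p₀ v)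
        (coordNormal f s₀ p₀) := by
  have : IsManifold 𝓘(ℝ, E') 1 S := .of_le (n := ∞) (by simp)
  have hc : ContinuousAt (fun q : S => (q, s₀)) p₀ := by fun_prop
  have hL := HasFDerivAt.comp (extChartAt 𝓘(ℝ, E') p₀ p₀) (f := fun e : E' => (e, s₀))
    (hasFDerivAt_fderiv_familyChart hJ hf hs p₀ (0, 1)) (hasFDerivAt_prodMk_left _ s₀)
  exact covDerivAlong_eq g.inner (N := coordNormal f s₀) hL
    (hc.eventually (eventually_coordDeriv_extChartAt_coordNormal hJ hf hs p₀)) v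

lemma normalAcceleration_eq :
    normalAcceleration g f s₀ p₀ = familyChartSecond (E' := E') f p₀ s₀ (0, 1) +
        christoffel g.inner (f s₀ p₀) (coordNormal f s₀ p₀) (coordNormal f s₀ p₀) := by
  have hc : ContinuousAt (fun r : ℝ => (p₀, r)) s₀ := by fun_prop
  have hL := HasFDerivAt.comp s₀ (f := fun r : ℝ => (extChartAt 𝓘(ℝ, E') p₀ p₀, r))
    (hasFDerivAt_fderiv_familyChart hJ hf hs p₀ (0, 1)) (hasFDerivAt_prodMk_right _ s₀)
  exact covDerivAlong_eq (I' := 𝓘(ℝ, ℝ)) g.inner (F := fun r => f r p₀)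
    (N := fun r => coordNormal f r p₀) hL
    (hc.eventually (eventually_coordDeriv_extChartAt_coordNormal hJ hf hs p₀)) (1 : ℝ)

variable {a : ℝ → ℝ} (ha : ContDiffOn ℝ ∞ a J)
include ha

omit [FiniteDimensional ℝ E] [IsManifold 𝓘(ℝ, E) ∞ M] [IsManifold 𝓘(ℝ, E') ∞ S] in
lemma coordDeriv_graphMap (w : E' × ℝ) :
    coordDeriv (𝓘(ℝ, E').prod 𝓘(ℝ, ℝ)) (𝓘(ℝ, E).prod 𝓘(ℝ, ℝ)) (graphMap f a) (p₀, s₀) w =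
      (coordDeriv 𝓘(ℝ, E') 𝓘(ℝ, E) (f s₀) p₀ w.1 + w.2 • coordNormal f s₀ p₀,
        deriv a s₀ * w.2) := by
  have h1 := ((contMDiffAt_family hJ hf hs p₀).mdifferentiableAt (by simp)).hasMFDerivAt
  have h2 : HasDerivAt a (deriv a s₀) s₀ :=
    ((ha.contDiffAt (hJ.mem_nhds hs)).differentiableAt (by simp)).hasDerivAt
  have h3 := HasMFDerivAt.comp (p₀, s₀) h2.hasFDerivAt.hasMFDerivAt
    (hasMFDerivAt_snd (I := 𝓘(ℝ, E')) (I' := 𝓘(ℝ, ℝ)) (x := (p₀, s₀)))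
  have h4 := (h1.prodMk h3).mfderiv
  have h5 := congrArg (fun L : E' × ℝ →L[ℝ] E × ℝ => L w) h4
  refine h5.trans (Prod.ext (coordDeriv_family_prod hJ hf hs p₀ w) ?_)
  exact mul_comm w.2 (deriv a s₀)

/-- The Leibniz rule for `N = (-ρ η, θ)`, with `θ' = -a' ρ'`. The geodesic equation is not used yet,
so the acceleration term is still present. -/
lemma graphNormalCovDeriv_eq (w : E' × ℝ) :
    graphNormalCovDeriv g f a (p₀, s₀) w =
      (-(w.2 * deriv (graphSin a) s₀) • coordNormal f s₀ p₀ -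
        graphSin a s₀ • normalCovDeriv g f s₀ p₀ w.1 -
        (graphSin a s₀ * w.2) • normalAcceleration g f s₀ p₀,
        -(deriv a s₀ * deriv (graphSin a) s₀) * w.2) := by
  have : IsManifold 𝓘(ℝ, E') 1 S := .of_le (n := ∞) (by simp)
  have : IsManifold 𝓘(ℝ, E) 1 M := .of_le (n := ∞) (by simp)
  have hV := hasFDerivAt_fderiv_familyChart hJ hf hs p₀ (0, 1)
  have hb := HasFDerivAt.comp (familyPoint E' p₀ s₀) (f := Prod.snd)
    (hasDerivAt_graphSin hJ ha hs).hasFDerivAt hasFDerivAt_snd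
  have hc := HasFDerivAt.comp (familyPoint E' p₀ s₀) (f := Prod.snd)
    (hasDerivAt_graphCos hJ ha hs).hasFDerivAt hasFDerivAt_snd
  have hL := (hb.neg.smul hV).prodMk hc
  have h : graphNormalCovDeriv g f a (p₀, s₀) w = _ :=
    covDerivAlong_eq (I' := 𝓘(ℝ, E').prod 𝓘(ℝ, ℝ)) (prodMetric g.inner)
      (F := graphMap f a) (p := (p₀, s₀))
      (N := coordGraphNormal f a) (by rw [extChartAt_prod_self]; exact hL) (by
        filter_upwards [eventually_coordDeriv_extChartAt_coordNormal hJ hf hs p₀,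
          eventually_mem_source hJ hf hs p₀] with x hx hx2
        rw [coordDeriv_extChartAt_prod _ _ (by simpa [graphMap] using hx2.2.2),
          coordGraphNormal_eq, map_smul]
        simp only [graphMap]
        rw [hx, extChartAt_prod]
        rfl) w
  rw [h, christoffel_prodMetric, coordGraphNormal_eq, coordDeriv_graphMap hJ hf hs p₀ ha,
    normalCovDeriv_eq g hJ hf hs p₀, normalAcceleration_eq g hJ hf hs p₀]
  simp only [graphMap]
  rw [christoffel_lincomb, coordNormal_eq hJ hf hs p₀]
  obtain ⟨v, r⟩ := w
  have hw : familyChartSecond (E := E) f p₀ s₀ (v, r) =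
      familyChartSecond f p₀ s₀ (v, 0) + r • familyChartSecond (E' := E') f p₀ s₀ (0, 1) := by
    rw [← map_smul, ← map_add]
    simp
  refine Prod.ext ?_ ?_
  · change (-graphSin a s₀) • familyChartSecond (E := E) f p₀ s₀ (v, r) +
      (-(r * deriv (graphSin a) s₀)) • _ + _ = _
    rw [hw]
    module
  · change r * -(deriv a s₀ * deriv (graphSin a) s₀) + 0 = _
    ring

end Derivatives

/-- Split `A` into a part factoring through `V` and a part factoring through `ℝ`; cyclicity moves
each trace to the smaller space. -/
lemma LinearMap.trace_prod_real {V : Type*} [AddCommGroup V] [Module ℝ V] [Module.Finite ℝ V]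
    (A : V × ℝ →ₗ[ℝ] V × ℝ) :
    LinearMap.trace ℝ (V × ℝ) A =
      LinearMap.trace ℝ V (LinearMap.fst ℝ V ℝ ∘ₗ A ∘ₗ LinearMap.inl ℝ V ℝ) + (A (0, 1)).2 := by
  have h : A = (A ∘ₗ LinearMap.inl ℝ V ℝ) ∘ₗ LinearMap.fst ℝ V ℝ +
      (A ∘ₗ LinearMap.inr ℝ V ℝ) ∘ₗ LinearMap.snd ℝ V ℝ := by
    refine LinearMap.ext fun w => ?_
    change A w = A (w.1, 0) + A (0, w.2)
    rw [← map_add]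
    simp
  have h2 (B : ℝ →ₗ[ℝ] ℝ) : LinearMap.trace ℝ ℝ B = B 1 := by
    have hB : B = B 1 • LinearMap.id := by ext; simp
    rw [hB, map_smul, LinearMap.trace_id]
    simp
  conv_lhs => rw [h]
  rw [map_add, LinearMap.trace_comp_comm' (LinearMap.fst ℝ V ℝ),
    LinearMap.trace_comp_comm' (LinearMap.snd ℝ V ℝ), h2]
  rfl

/-! ### Mean curvature of the graph against that of the hypersurfaces -/

section Graph

variable {E : Type*} [NormedAddCommGroup E] [NormedSpace ℝ E] [FiniteDimensional ℝ E]
  {M : Type*} [TopologicalSpace M] [ChartedSpace E M] [IsManifold 𝓘(ℝ, E) ∞ M]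
  {E' : Type*} [NormedAddCommGroup E'] [NormedSpace ℝ E'] [FiniteDimensional ℝ E']
  {S : Type*} [TopologicalSpace S] [ChartedSpace E' S] [IsManifold 𝓘(ℝ, E') ∞ S]
  {g : Bundle.ContMDiffRiemannianMetric 𝓘(ℝ, E) ∞ E (fun x : M => TangentSpace 𝓘(ℝ, E) x)}
  {f : ℝ → S → M} {J : Set ℝ} {a : ℝ → ℝ}

/-- Both sides agree by definition. The right side lives on the model spaces, where rewriting is not
obstructed by tangent space types. -/
lemma hasConstMeanCurvatureOn_family_iff {s h : ℝ} :
    HasConstMeanCurvatureOn 𝓘(ℝ, E') g.inner (f s) (familyNormal 𝓘(ℝ, E) f s) univ h ↔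
    ∀ p, Function.Injective (coordDeriv 𝓘(ℝ, E') 𝓘(ℝ, E) (f s) p) ∧
      (coordMetric g.inner (f s p) (coordNormal f s p) (coordNormal f s p) = 1 ∧
        ∀ v : E', coordMetric g.inner (f s p) (coordNormal f s p)
          (coordDeriv 𝓘(ℝ, E') 𝓘(ℝ, E) (f s) p v) = 0) ∧
      ∃ A : E' →ₗ[ℝ] E',
        (∀ v, coordDeriv 𝓘(ℝ, E') 𝓘(ℝ, E) (f s) p (A v) = -normalCovDeriv g f s p v) ∧
          LinearMap.trace ℝ E' A = h :=
  ⟨fun H p => H p (mem_univ p), fun H p _ => H p⟩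

lemma graphHasConstMeanCurvature_iff {h : ℝ} :
    GraphHasConstMeanCurvature 𝓘(ℝ, E') g.inner J f a h ↔
    ∀ s ∈ J, ∀ p, Function.Injective
        (coordDeriv (𝓘(ℝ, E').prod 𝓘(ℝ, ℝ)) (𝓘(ℝ, E).prod 𝓘(ℝ, ℝ)) (graphMap f a) (p, s)) ∧
      (coordMetric (prodMetric g.inner) (graphMap f a (p, s)) (coordGraphNormal f a (p, s))
          (coordGraphNormal f a (p, s)) = 1 ∧
        ∀ w : E' × ℝ, coordMetric (prodMetric g.inner) (graphMap f a (p, s))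
          (coordGraphNormal f a (p, s))
          (coordDeriv (𝓘(ℝ, E').prod 𝓘(ℝ, ℝ)) (𝓘(ℝ, E).prod 𝓘(ℝ, ℝ)) (graphMap f a) (p, s) w) =
            0) ∧
      ∃ A : E' × ℝ →ₗ[ℝ] E' × ℝ,
        (∀ w, coordDeriv (𝓘(ℝ, E').prod 𝓘(ℝ, ℝ)) (𝓘(ℝ, E).prod 𝓘(ℝ, ℝ)) (graphMap f a) (p, s)
          (A w) = -graphNormalCovDeriv g f a (p, s) w) ∧ LinearMap.trace ℝ (E' × ℝ) A = h :=
  ⟨fun H s hs p => H (p, s) ⟨mem_univ p, hs⟩, fun H x hx => H x.2 hx.2 x.1⟩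

variable (hG : IsParallelGraph 𝓘(ℝ, E') g.inner J f a)
include hG

lemma IsParallelGraph.coordDeriv_graphMap {s : ℝ} (hs : s ∈ J) (p : S) (w : E' × ℝ) :
    coordDeriv (𝓘(ℝ, E').prod 𝓘(ℝ, ℝ)) (𝓘(ℝ, E).prod 𝓘(ℝ, ℝ)) (graphMap f a) (p, s) w =
      (coordDeriv 𝓘(ℝ, E') 𝓘(ℝ, E) (f s) p w.1 + w.2 • coordNormal f s p, deriv a s * w.2) :=
  _root_.coordDeriv_graphMap hG.parallel.isOpen hG.parallel.smooth hs p hG.smooth w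

lemma IsParallelGraph.graphNormalCovDeriv_eq {s : ℝ} (hs : s ∈ J) (p : S) (w : E' × ℝ) :
    graphNormalCovDeriv g f a (p, s) w =
      (-(w.2 * deriv (graphSin a) s) • coordNormal f s p - graphSin a s • normalCovDeriv g f s p w.1,
        -(deriv a s * deriv (graphSin a) s) * w.2) := by
  have h : normalAcceleration g f s p = 0 := (hG.parallel.geodesic p).2 s hs
  rw [_root_.graphNormalCovDeriv_eq g hG.parallel.isOpen hG.parallel.smooth hs p hG.smooth w, h,
    smul_zero, sub_zero]

lemma IsParallelGraph.graphSin_pos {s : ℝ} (hs : s ∈ J) : 0 < graphSin a s := by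
  rw [graphSin_eq]
  exact mul_pos (hG.deriv_pos s hs) (graphCos_pos a s)

/-- The shape operator of the graph in terms of the one of the parallel hypersurface. -/
lemma IsParallelGraph.coordDeriv_graphShape {s : ℝ} (hs : s ∈ J) (p : S) {A : E' →ₗ[ℝ] E'}
    (hA : ∀ v, coordDeriv 𝓘(ℝ, E') 𝓘(ℝ, E) (f s) p (A v) = -normalCovDeriv g f s p v)
    (w : E' × ℝ) :
    coordDeriv (𝓘(ℝ, E').prod 𝓘(ℝ, ℝ)) (𝓘(ℝ, E).prod 𝓘(ℝ, ℝ)) (graphMap f a) (p, s)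
      ((((-graphSin a s) • A).prodMap (deriv (graphSin a) s • LinearMap.id)) w) =
        -graphNormalCovDeriv g f a (p, s) w := by
  rw [hG.coordDeriv_graphMap hs p, hG.graphNormalCovDeriv_eq hs p]
  refine Prod.ext ?_ ?_
  · simp only [LinearMap.prodMap_apply, LinearMap.smul_apply, LinearMap.id_apply, map_smul, hA,
      Prod.fst_neg, smul_eq_mul]
    module
  · simp only [LinearMap.prodMap_apply, LinearMap.smul_apply, LinearMap.id_apply, Prod.snd_neg,
      smul_eq_mul]
    ring

/-- The trace of the block operator is `ρ' - ρ H_s`. Injectivity uses `a' > 0`, and the metric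
conditions on `N` follow from those on `η_s`, which are part of the hypothesis for every `s`. -/
lemma IsParallelGraph.graphHasConstMeanCurvature {Hs : ℝ → ℝ} {H : ℝ}
    (hI : ∀ s ∈ J, HasConstMeanCurvatureOn 𝓘(ℝ, E') g.inner (f s) (familyNormal 𝓘(ℝ, E) f s) univ
      (Hs s))
    (hode : ∀ s ∈ J, deriv (graphSin a) s = Hs s * graphSin a s + H) :
    GraphHasConstMeanCurvature 𝓘(ℝ, E') g.inner J f a H := by
  rw [graphHasConstMeanCurvature_iff]
  intro s hs p
  obtain ⟨hinj, ⟨hunit, hnormal⟩, A, hA, htr⟩ := hasConstMeanCurvatureOn_family_iff.1 (hI s hs) p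
  refine ⟨?_, ⟨?_, fun w => ?_⟩, _, hG.coordDeriv_graphShape hs p hA, ?_⟩
  · rw [injective_iff_map_eq_zero]
    intro w hw
    rw [hG.coordDeriv_graphMap hs p, Prod.mk_eq_zero] at hw
    have h2 : w.2 = 0 := (mul_eq_zero.1 hw.2).resolve_left (hG.deriv_pos s hs).ne'
    rw [h2, zero_smul, add_zero] at hw
    exact Prod.ext ((injective_iff_map_eq_zero _).1 hinj _ hw.1) h2
  · rw [coordMetric_prodMetric, coordGraphNormal_eq]
    simp only [graphMap, map_smul, smul_apply, hunit, smul_eq_mul]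
    linarith [graphSin_sq_add_graphCos_sq a s]
  · rw [coordMetric_prodMetric, coordGraphNormal_eq, hG.coordDeriv_graphMap hs p]
    simp only [graphMap, map_smul, map_add, smul_apply, hunit, hnormal, smul_eq_mul]
    rw [graphSin_eq]
    ring
  · rw [LinearMap.trace_prodMap', map_smul, map_smul, htr, hode s hs, LinearMap.trace_id]
    simp
    ring

/-- The value is the solution `H_s` of `ρ' = H_s ρ + H`. No Gauss lemma is needed: that `η_s` is a
unit normal is read off from `N`, because `ρ ≠ 0`. The operator `A_s` is `-ρ⁻¹` times the `E'` block
of the given one. -/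
lemma IsParallelGraph.hasConstMeanCurvatureOn {H : ℝ}
    (hH : GraphHasConstMeanCurvature 𝓘(ℝ, E') g.inner J f a H) {s : ℝ} (hs : s ∈ J) :
    HasConstMeanCurvatureOn 𝓘(ℝ, E') g.inner (f s) (familyNormal 𝓘(ℝ, E) f s) univ
      ((deriv (graphSin a) s - H) / graphSin a s) := by
  rw [hasConstMeanCurvatureOn_family_iff]
  intro p
  obtain ⟨-, ⟨hunit, hnormal⟩, A, hA, htr⟩ := graphHasConstMeanCurvature_iff.1 hH s hs p
  have hb := hG.graphSin_pos hs
  have ha := hG.deriv_pos s hs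
  have hinj : Function.Injective (coordDeriv 𝓘(ℝ, E') 𝓘(ℝ, E) (f s) p) :=
    hG.parallel.immersion s hs p
  refine ⟨hinj, ⟨?_, fun v => ?_⟩, (-(graphSin a s)⁻¹) •
    (LinearMap.fst ℝ E' ℝ ∘ₗ A ∘ₗ LinearMap.inl ℝ E' ℝ), fun v => ?_, ?_⟩
  · rw [coordMetric_prodMetric, coordGraphNormal_eq] at hunit
    simp only [graphMap, map_smul, smul_apply, smul_eq_mul] at hunit
    have h := graphSin_sq_add_graphCos_sq a s
    have h2 : graphSin a s ^ 2 * (coordMetric g.inner (f s p) (coordNormal f s p)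
      (coordNormal f s p) - 1) = 0 := by linarith
    linarith [(mul_eq_zero.1 h2).resolve_left (by positivity)]
  · have h := hnormal (v, 0)
    rw [coordMetric_prodMetric, coordGraphNormal_eq, hG.coordDeriv_graphMap hs p] at h
    simp only [graphMap, map_smul, smul_apply, zero_smul, smul_eq_mul, mul_zero,
      add_zero] at h
    exact (mul_eq_zero.1 h).resolve_left (neg_ne_zero.2 hb.ne')
  -- The vertical component, divided by `a'`, shows that `A` maps `E' × 0` into itself; the
  -- horizontal component then gives the shape equation for `f s`.
  · have h := hA (v, 0)
    rw [hG.coordDeriv_graphMap hs p, hG.graphNormalCovDeriv_eq hs p] at h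
    have h2 : (A (v, 0)).2 = 0 := by
      have := congrArg Prod.snd h
      simp only [Prod.snd_neg, mul_zero, neg_zero] at this
      exact (mul_eq_zero.1 this).resolve_left ha.ne'
    have h1 := congrArg Prod.fst h
    simp only [h2, zero_smul, add_zero, zero_mul, neg_zero, zero_sub, Prod.fst_neg, neg_neg] at h1
    simp only [LinearMap.smul_apply, LinearMap.comp_apply, LinearMap.inl_apply,
      LinearMap.fst_apply, map_smul, h1, smul_smul]
    rw [neg_mul, inv_mul_cancel₀ hb.ne', neg_one_smul]
  -- The vertical component along `∂_s` identifies the remaining diagonal entry of `A` as `ρ'`.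
  · have h := congrArg Prod.snd (hA (0, 1))
    rw [hG.coordDeriv_graphMap hs p, hG.graphNormalCovDeriv_eq hs p] at h
    simp only [Prod.snd_neg, mul_one, neg_neg] at h
    have h2 := mul_left_cancel₀ ha.ne' h
    rw [LinearMap.trace_prod_real, h2] at htr
    rw [map_smul, smul_eq_mul]
    field_simp
    linarith

end Graph

/-- An operator and its adjoint with respect to a nondegenerate bilinear form have the same
trace. -/
lemma LinearMap.trace_eq_of_adjoint {V : Type*} [AddCommGroup V] [Module ℝ V] [Module.Finite ℝ V]
    (e : V ≃ₗ[ℝ] Module.Dual ℝ V) {A B : V →ₗ[ℝ] V} (h : ∀ v w, e (B v) w = e v (A w)) :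
    LinearMap.trace ℝ V B = LinearMap.trace ℝ V A := by
  have hB : B = e.symm.conj (Module.Dual.transpose (R := ℝ) A) := by
    ext v
    rw [LinearEquiv.conj_apply]
    apply e.injective
    ext w
    simp [h, Module.Dual.transpose_apply]
  rw [hB, LinearMap.trace_conj', LinearMap.trace_transpose']

/-! ### First variation of the induced metric and smoothness of `H_s` -/

section Gram

variable {E : Type*} [NormedAddCommGroup E] [NormedSpace ℝ E] [FiniteDimensional ℝ E]
  {M : Type*} [TopologicalSpace M] [ChartedSpace E M] [IsManifold 𝓘(ℝ, E) ∞ M]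
  {E' : Type*} [NormedAddCommGroup E'] [NormedSpace ℝ E'] [FiniteDimensional ℝ E']
  {S : Type*} [TopologicalSpace S] [ChartedSpace E' S] [IsManifold 𝓘(ℝ, E') ∞ S]
  (g : Bundle.ContMDiffRiemannianMetric 𝓘(ℝ, E) ∞ E (fun x : M => TangentSpace 𝓘(ℝ, E) x))
  {f : ℝ → S → M} {J : Set ℝ}

/-- The metric induced at `p` by the immersion `f s`. -/
def inducedMetric (f : ℝ → S → M) (p : S) (s : ℝ) : E' →L[ℝ] E' →L[ℝ] ℝ :=
  (coordMetric g.inner (f s p)).bilinearComp (coordDeriv 𝓘(ℝ, E') 𝓘(ℝ, E) (f s) p)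
    (coordDeriv 𝓘(ℝ, E') 𝓘(ℝ, E) (f s) p)

lemma inducedMetric_apply (p : S) (s : ℝ) (v w : E') :
    inducedMetric g f p s v w = coordMetric g.inner (f s p)
      (coordDeriv 𝓘(ℝ, E') 𝓘(ℝ, E) (f s) p v) (coordDeriv 𝓘(ℝ, E') 𝓘(ℝ, E) (f s) p w) := rfl

variable (hJ : IsOpen J)
  (hf : ContMDiffOn (𝓘(ℝ, E').prod 𝓘(ℝ, ℝ)) 𝓘(ℝ, E) ∞ (fun x : S × ℝ => f x.2 x.1) (univ ×ˢ J))
  {s₀ : ℝ} (hs : s₀ ∈ J) (p₀ : S)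
include hJ hf hs

/-- The point `f s p₀` moves with `s`; keeping the chart at `f s₀ p₀` fixed for nearby `s` gives an
expression that can be differentiated. -/
lemma eventually_inducedMetric_apply (v w : E') :
    ∀ᶠ s in 𝓝 s₀, inducedMetric g f p₀ s v w =
      chartMetric g.inner (f s₀ p₀) (familyChart f p₀ s₀ (extChartAt 𝓘(ℝ, E') p₀ p₀, s))
        (fderiv ℝ (familyChart f p₀ s₀) (extChartAt 𝓘(ℝ, E') p₀ p₀, s) (v, 0))
        (fderiv ℝ (familyChart f p₀ s₀) (extChartAt 𝓘(ℝ, E') p₀ p₀, s) (w, 0)) := by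
  have hc : ContinuousAt (fun s : ℝ => (p₀, s)) s₀ := by fun_prop
  filter_upwards [eventually_coordDeriv_extChartAt_family hJ hf hs p₀,
    hc.eventually (eventually_mem_source hJ hf hs p₀)] with s h1 h2
  rw [← h1 v, ← h1 w, familyChart_extChartAt p₀ (mem_extChartAt_source p₀),
    chartMetric_coordDeriv g.inner h2.2.2, inducedMetric_apply]

lemma contDiffAt_inducedMetric_apply (v w : E') :
    ContDiffAt ℝ ∞ (fun s => inducedMetric g f p₀ s v w) s₀ := by
  refine ContDiffAt.congr_of_eventuallyEq ?_ (eventually_inducedMetric_apply g hJ hf hs p₀ v w)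
  have hc : ContDiffAt ℝ ∞ (fun s : ℝ => (extChartAt 𝓘(ℝ, E') p₀ p₀, s)) s₀ :=
    contDiffAt_const.prodMk contDiffAt_id
  have hφ := contDiffAt_familyChart hJ hf hs p₀
  have h1 (u : E') : ContDiffAt ℝ ∞ (fun s =>
      fderiv ℝ (familyChart (E := E) f p₀ s₀) (extChartAt 𝓘(ℝ, E') p₀ p₀, s) (u, 0)) s₀ :=
    (ContDiffAt.comp s₀ (f := fun s : ℝ => (extChartAt 𝓘(ℝ, E') p₀ p₀, s))
      (hφ.fderiv_right (m := ∞) (by simp)) hc).clm_apply contDiffAt_const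
  have h2 : ContDiffAt ℝ ∞ (fun s => chartMetric g.inner (f s₀ p₀)
      (familyChart f p₀ s₀ (extChartAt 𝓘(ℝ, E') p₀ p₀, s))) s₀ :=
    ContDiffAt.comp s₀ (g := chartMetric g.inner (f s₀ p₀))
      (f := fun s => familyChart f p₀ s₀ (extChartAt 𝓘(ℝ, E') p₀ p₀, s))
      (by
        rw [familyChart_extChartAt p₀ (mem_extChartAt_source p₀) s₀]
        exact contDiffAt_chartMetric g (f s₀ p₀))
      (ContDiffAt.comp s₀ (g := familyChart (E := E) f p₀ s₀) hφ hc)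
  exact (h2.clm_apply (h1 v)).clm_apply (h1 w)

/-- Symmetry of the second derivative exchanges `∂_s ∂_v` for `∂_v ∂_s`, the derivative of the
normal field along `v`. -/
lemma hasDerivAt_fderiv_familyChart (v : E') :
    HasDerivAt (fun s => fderiv ℝ (familyChart (E := E) f p₀ s₀)
      (extChartAt 𝓘(ℝ, E') p₀ p₀, s) (v, 0)) (familyChartSecond f p₀ s₀ (v, 0)) s₀ := by
  have hφ := contDiffAt_familyChart hJ hf hs p₀
  have hd := (hφ.fderiv_right (m := ∞) (by simp)).differentiableAt (by simp)
  have hsymm : IsSymmSndFDerivAt ℝ (familyChart (E := E) f p₀ s₀) (familyPoint E' p₀ s₀) :=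
    hφ.isSymmSndFDerivAt (by simpa using ENat.LEInfty.out)
  have h1 := HasFDerivAt.comp s₀ (f := fun s : ℝ => (extChartAt 𝓘(ℝ, E') p₀ p₀, s))
    (hd.hasFDerivAt.clm_apply (hasFDerivAt_const ((v, 0) : E' × ℝ) _))
    (hasFDerivAt_prodMk_right _ s₀)
  have h2 := (hd.hasFDerivAt.clm_apply
    (hasFDerivAt_const ((0, 1) : E' × ℝ) (familyPoint E' p₀ s₀))).fderiv
  refine h1.hasDerivAt.congr_deriv ?_
  have h3 : familyChartSecond (E' := E') f p₀ s₀ = _ := h2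
  rw [h3]
  simpa using hsymm.eq (0, 1) (v, 0)

set_option synthInstance.maxHeartbeats 200000 in
-- Leibniz rule in the fixed chart: the derivative of the metric coefficients along `η` splits into
-- two Christoffel terms by `coordMetric_christoffel_add`, and each completes a second derivative of
-- `familyChart` to `∇η`.
lemma hasDerivAt_inducedMetric_apply (v w : E') :
    HasDerivAt (fun s => inducedMetric g f p₀ s v w)
      (coordMetric g.inner (f s₀ p₀) (normalCovDeriv g f s₀ p₀ v)
          (coordDeriv 𝓘(ℝ, E') 𝓘(ℝ, E) (f s₀) p₀ w) +
        coordMetric g.inner (f s₀ p₀) (normalCovDeriv g f s₀ p₀ w)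
          (coordDeriv 𝓘(ℝ, E') 𝓘(ℝ, E) (f s₀) p₀ v)) s₀ := by
  refine HasDerivAt.congr_of_eventuallyEq ?_ (eventually_inducedMetric_apply g hJ hf hs p₀ v w)
  have hφ := (contDiffAt_familyChart (E := E) hJ hf hs p₀).differentiableAt (by simp)
  have hpt : familyChart (E := E) f p₀ s₀ (extChartAt 𝓘(ℝ, E') p₀ p₀, s₀) =
      extChartAt 𝓘(ℝ, E) (f s₀ p₀) (f s₀ p₀) :=
    familyChart_extChartAt p₀ (mem_extChartAt_source p₀) s₀
  have h0 := HasFDerivAt.comp s₀ (f := fun s : ℝ => (extChartAt 𝓘(ℝ, E') p₀ p₀, s))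
    hφ.hasFDerivAt (hasFDerivAt_prodMk_right _ s₀)
  have hm := ((contDiffAt_chartMetric g (f s₀ p₀)).differentiableAt (by simp)).hasFDerivAt
  rw [← hpt] at hm
  have h1 := (HasFDerivAt.comp s₀ hm h0).hasDerivAt
  have h2 := (h1.clm_apply (hasDerivAt_fderiv_familyChart hJ hf hs p₀ v)).clm_apply
    (hasDerivAt_fderiv_familyChart hJ hf hs p₀ w)
  refine h2.congr_deriv ?_
  have hΓ := coordMetric_christoffel_add g (f s₀ p₀) (coordDeriv 𝓘(ℝ, E') 𝓘(ℝ, E) (f s₀) p₀ v)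
    (coordNormal f s₀ p₀) (coordDeriv 𝓘(ℝ, E') 𝓘(ℝ, E) (f s₀) p₀ w)
  have hη := coordNormal_eq (E := E) hJ hf hs p₀
  have hv := coordDeriv_family (E := E) hJ hf hs p₀
  rw [normalCovDeriv_eq g hJ hf hs p₀, normalCovDeriv_eq g hJ hf hs p₀, map_add, map_add,
    add_apply, add_apply]
  simp only [familyPoint] at hη hv
  rw [← hv v, ← hv w]
  simp only [Function.comp_apply, ContinuousLinearMap.comp_apply, ContinuousLinearMap.inr_apply,
    hpt, chartMetric_self, familyPoint, ← hη]
  rw [← hΓ, add_apply, coordMetric_symm g (f s₀ p₀) (coordDeriv 𝓘(ℝ, E') 𝓘(ℝ, E) (f s₀) p₀ v)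
    (familyChartSecond f p₀ s₀ (w, 0))]
  ring

omit hs in
lemma contDiffOn_inducedMetric : ContDiffOn ℝ ∞ (inducedMetric (E' := E') g f p₀) J := by
  rw [contDiffOn_clm_apply]
  intro v
  rw [contDiffOn_clm_apply]
  exact fun w s hs => (contDiffAt_inducedMetric_apply g hJ hf hs p₀ v w).contDiffWithinAt

set_option synthInstance.maxHeartbeats 200000 in
lemma deriv_inducedMetric_apply (v w : E') :
    deriv (inducedMetric g f p₀) s₀ v w =
      coordMetric g.inner (f s₀ p₀) (normalCovDeriv g f s₀ p₀ v)
          (coordDeriv 𝓘(ℝ, E') 𝓘(ℝ, E) (f s₀) p₀ w) +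
        coordMetric g.inner (f s₀ p₀) (normalCovDeriv g f s₀ p₀ w)
          (coordDeriv 𝓘(ℝ, E') 𝓘(ℝ, E) (f s₀) p₀ v) := by
  have h1 := (((contDiffOn_inducedMetric g hJ hf p₀).contDiffAt (hJ.mem_nhds hs)).differentiableAt
    (by simp)).hasDerivAt
  have h2 := (h1.clm_apply (hasDerivAt_const s₀ v)).clm_apply (hasDerivAt_const s₀ w)
  simpa using h2.unique (hasDerivAt_inducedMetric_apply g hJ hf hs p₀ v w)

omit hJ hf hs in
lemma inducedMetric_pos {s : ℝ} {p : S}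
    (hinj : Function.Injective (coordDeriv 𝓘(ℝ, E') 𝓘(ℝ, E) (f s) p)) {v : E'} (hv : v ≠ 0) :
    0 < inducedMetric g f p s v v :=
  coordMetric_pos g (f s p) fun h => hv ((injective_iff_map_eq_zero _).1 hinj v h)

set_option synthInstance.maxHeartbeats 200000 in
/-- The mean curvature of `f s` at `p₀` in terms of the first variation of the induced metric. -/
lemma trace_shape_eq (hinj : Function.Injective (coordDeriv 𝓘(ℝ, E') 𝓘(ℝ, E) (f s₀) p₀))
    {A : E' →ₗ[ℝ] E'}
    (hA : ∀ v, coordDeriv 𝓘(ℝ, E') 𝓘(ℝ, E) (f s₀) p₀ (A v) = -normalCovDeriv g f s₀ p₀ v) :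
    LinearMap.trace ℝ E' A = -(1 / 2) * LinearMap.trace ℝ E'
      ((inducedMetric g f p₀ s₀).inverse.comp (deriv (inducedMetric g f p₀) s₀) : E' →L[ℝ] E') := by
  obtain ⟨e, he⟩ := ContinuousLinearMap.isInvertible_of_pos fun v hv =>
    inducedMetric_pos g hinj (v := v) hv
  have he2 (v w : E') : e v w = inducedMetric g f p₀ s₀ v w := by rw [← he]; rfl
  let e' : E' ≃ₗ[ℝ] Module.Dual ℝ E' :=
    e.toLinearEquiv.trans (LinearMap.toContinuousLinearMap (𝕜 := ℝ) (E := E') (F' := ℝ)).symm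
  have he' (v w : E') : e' v w = inducedMetric g f p₀ s₀ v w := he2 v w
  have hn (v : E') : normalCovDeriv g f s₀ p₀ v =
      -coordDeriv 𝓘(ℝ, E') 𝓘(ℝ, E) (f s₀) p₀ (A v) := by rw [hA, neg_neg]
  -- `B` is the adjoint of `A` for the induced metric. Since it has the same trace as `A`,
  -- self-adjointness of the shape operator need not be proved.
  set B : E' →ₗ[ℝ] E' := e'.symm.conj (Module.Dual.transpose (R := ℝ) A)
  have hB (v w : E') : e' (B v) w = e' v (A w) := by
    simp [B, LinearEquiv.conj_apply, Module.Dual.transpose_apply]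
  -- The first variation reads `G' = -G (A + B)`, because `∇_v η = -df (A v)`.
  have hC : (((inducedMetric g f p₀ s₀).inverse.comp (deriv (inducedMetric g f p₀) s₀) :
      E' →L[ℝ] E') : E' →ₗ[ℝ] E') = -(A + B) := by
    ext v
    change (inducedMetric g f p₀ s₀).inverse (deriv (inducedMetric g f p₀) s₀ v) = -(A v + B v)
    rw [← he, ContinuousLinearMap.inverse_equiv]
    change e.symm _ = _
    rw [ContinuousLinearEquiv.symm_apply_eq]
    ext w
    have h2 : e (B v) w = inducedMetric g f p₀ s₀ v (A w) := by rw [he2, ← he', hB, he']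
    have h3 : e (-(A v + B v)) w = -(e (A v) w + e (B v) w) := by
      rw [map_neg, map_add, neg_apply, add_apply]
    rw [h3, he2 (A v), h2, deriv_inducedMetric_apply g hJ hf hs, hn, hn, inducedMetric_apply,
      inducedMetric_apply, map_neg, map_neg, neg_apply, neg_apply,
      coordMetric_symm g (f s₀ p₀) (coordDeriv 𝓘(ℝ, E') 𝓘(ℝ, E) (f s₀) p₀ (A w))]
    ring
  rw [hC, map_neg, map_add, LinearMap.trace_eq_of_adjoint e' hB]
  ring

omit hs in
include p₀ in
/-- The mean curvature of an isoparametric family is a smooth function. -/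
lemma contDiffOn_meanCurvature {Hs : ℝ → ℝ} (hI : ∀ s ∈ J, HasConstMeanCurvatureOn 𝓘(ℝ, E')
      g.inner (f s) (familyNormal 𝓘(ℝ, E) f s) univ (Hs s)) : ContDiffOn ℝ ∞ Hs J := by
  have hG := contDiffOn_inducedMetric g hJ hf p₀
  have hG' := ((contDiffOn_infty_iff_deriv_of_isOpen hJ).1 hG).2
  have hinv : ContDiffOn ℝ ∞ (fun s => (inducedMetric (E' := E') g f p₀ s).inverse) J := by
    intro s hs
    obtain ⟨e, he⟩ := ContinuousLinearMap.isInvertible_of_pos fun v hv =>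
      inducedMetric_pos g (hasConstMeanCurvatureOn_family_iff.1 (hI s hs) p₀).1 (v := v) hv
    have h := contDiffAt_map_inverse (𝕜 := ℝ) (n := ∞) e
    rw [he] at h
    exact h.comp_contDiffWithinAt s (hG s hs)
  -- The trace is a continuous linear functional, hence smooth, so `-(1/2) tr (G⁻¹ G')` is smooth in
  -- `s`; the single point `p₀` suffices because `H_s` does not depend on the point.
  let T : (E' →L[ℝ] E') →L[ℝ] ℝ := LinearMap.toContinuousLinearMap
    (LinearMap.trace ℝ E' ∘ₗ ContinuousLinearMap.coeLM ℝ)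
  have hT := (contDiffOn_const (c := (-(1 / 2) : ℝ))).mul
    (T.contDiff.comp_contDiffOn (hinv.clm_comp hG'))
  refine hT.congr fun s hs => ?_
  obtain ⟨hinj, -, A, hA, htr⟩ := hasConstMeanCurvatureOn_family_iff.1 (hI s hs) p₀
  rw [← htr, trace_shape_eq g hJ hf hs p₀ hinj hA]
  rfl

end Gram

/-! ### Primitives and the linear equation for `ρ` -/

section Primitive

variable {J : Set ℝ} {φ : ℝ → ℝ} {s₀ s : ℝ}

lemma intervalIntegrable_of_continuousOn_ordConnected (hJ : J.OrdConnected)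
    (hφ : ContinuousOn φ J) (hs₀ : s₀ ∈ J) (hs : s ∈ J) :
    IntervalIntegrable φ MeasureTheory.volume s₀ s :=
  (hφ.mono (hJ.uIcc_subset hs₀ hs)).intervalIntegrable

lemma hasDerivAt_integral_of_continuousOn (hJo : IsOpen J) (hJ : J.OrdConnected)
    (hφ : ContinuousOn φ J) (hs₀ : s₀ ∈ J) (hs : s ∈ J) :
    HasDerivAt (fun r => ∫ τ in s₀..r, φ τ) (φ s) s :=
  intervalIntegral.integral_hasDerivAt_right
    (intervalIntegrable_of_continuousOn_ordConnected hJ hφ hs₀ hs)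
    (hφ.stronglyMeasurableAtFilter hJo s hs) (hφ.continuousAt (hJo.mem_nhds hs))

lemma contDiffOn_integral (hJo : IsOpen J) (hJ : J.OrdConnected)
    (hφ : ContDiffOn ℝ ∞ φ J) (hs₀ : s₀ ∈ J) :
    ContDiffOn ℝ ∞ (fun r => ∫ τ in s₀..r, φ τ) J := by
  have h (s : ℝ) (hs : s ∈ J) := hasDerivAt_integral_of_continuousOn hJo hJ hφ.continuousOn hs₀ hs
  rw [contDiffOn_infty_iff_deriv_of_isOpen hJo]
  exact ⟨fun s hs => (h s hs).differentiableAt.differentiableWithinAt,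
    hφ.congr fun s hs => (h s hs).deriv⟩

/-- Local solvability of a linear equation with values in `(0, 1)`. -/
lemma exists_linear_ode_solution (hJo : IsOpen J) (hJ : J.OrdConnected)
    (hφ : ContDiffOn ℝ ∞ φ J) (hs₀ : s₀ ∈ J) (H : ℝ) {U : Set ℝ} (hU : U ∈ 𝓝 s₀) :
    ∃ J' ⊆ J ∩ U, IsOpen J' ∧ J'.OrdConnected ∧ s₀ ∈ J' ∧ ∃ ρ : ℝ → ℝ, ContDiffOn ℝ ∞ ρ J' ∧
      ∀ s ∈ J', HasDerivAt ρ (φ s * ρ s + H) s ∧ 0 < ρ s ∧ ρ s < 1 := by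
  set P : ℝ → ℝ := fun r => ∫ τ in s₀..r, φ τ
  have hP : ContDiffOn ℝ ∞ P J := contDiffOn_integral hJo hJ hφ hs₀
  have hexp : ContDiffOn ℝ ∞ (fun s => Real.exp (-P s)) J := hP.neg.exp
  set Q : ℝ → ℝ := fun r => ∫ τ in s₀..r, Real.exp (-P τ)
  have hQ : ContDiffOn ℝ ∞ Q J := contDiffOn_integral hJo hJ hexp hs₀
  -- Variation of constants with initial value `1 / 2`, for which any number in `(0, 1)` would do;
  -- continuity keeps `ρ` in `(0, 1)` near `s₀`.
  set ρ : ℝ → ℝ := fun s => Real.exp (P s) * (1 / 2 + H * Q s)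
  have hρ : ContDiffOn ℝ ∞ ρ J :=
    hP.exp.mul (contDiffOn_const.add (contDiffOn_const.mul hQ))
  have hρ₀ : ρ s₀ = 1 / 2 := by simp [ρ, P, Q]
  have hcont : ContinuousAt ρ s₀ := hρ.continuousOn.continuousAt (hJo.mem_nhds hs₀)
  have hev : ∀ᶠ s in 𝓝 s₀, s ∈ J ∩ U ∧ 0 < ρ s ∧ ρ s < 1 :=
    (show ∀ᶠ s in 𝓝 s₀, s ∈ J ∩ U from inter_mem (hJo.mem_nhds hs₀) hU).and
      ((hcont.eventually_const_lt (by rw [hρ₀]; norm_num)).and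
        (hcont.eventually_lt_const (by rw [hρ₀]; norm_num)))
  obtain ⟨ε, hε, hball⟩ := Metric.eventually_nhds_iff_ball.1 hev
  refine ⟨Metric.ball s₀ ε, fun s hs => (hball s hs).1, Metric.isOpen_ball,
    by rw [Real.ball_eq_Ioo]; exact ordConnected_Ioo, Metric.mem_ball_self hε, ρ,
    hρ.mono fun s hs => (hball s hs).1.1, fun s hs => ⟨?_, (hball s hs).2⟩⟩
  have hsJ := (hball s hs).1.1
  have hP' : HasDerivAt P (φ s) s :=
    hasDerivAt_integral_of_continuousOn hJo hJ hφ.continuousOn hs₀ hsJ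
  have hQ' : HasDerivAt Q (Real.exp (-P s)) s :=
    hasDerivAt_integral_of_continuousOn hJo hJ hexp.continuousOn hs₀ hsJ
  refine (hP'.exp.mul ((hQ'.const_mul H).const_add (1 / 2))).congr_deriv ?_
  have h1 : Real.exp (P s) * Real.exp (-P s) = 1 := by rw [← Real.exp_add]; simp
  simp only [ρ]
  linear_combination H * h1

end Primitive

/-! ### Recovering `a` from `ρ` -/

section Slope

variable {a ρ : ℝ → ℝ} {J : Set ℝ} {s s₀ : ℝ}

/-- On `(0, 1)` the map `r ↦ r / √(1 - r²)` is inverted by `x ↦ x / √(1 + x²)`. -/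
lemma graphSin_of_deriv_eq {r : ℝ} (hr : 0 < r) (hr' : r < 1) (h : deriv a s = r / √(1 - r ^ 2)) :
    graphSin a s = r := by
  have h1 : 0 < 1 - r ^ 2 := by nlinarith
  have h2 : 1 + deriv a s ^ 2 = 1 / (1 - r ^ 2) := by
    rw [h, div_pow, Real.sq_sqrt h1.le]
    field_simp
    ring
  have h3 := Real.sqrt_pos.2 h1
  rw [graphSin, h2, Real.sqrt_div zero_le_one, Real.sqrt_one, h]
  field_simp

lemma sqrt_one_sub_graphCos_sq (h : 0 < graphSin a s) : √(1 - graphCos a s ^ 2) = graphSin a s := by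
  rw [show 1 - graphCos a s ^ 2 = graphSin a s ^ 2 by linarith [graphSin_sq_add_graphCos_sq a s],
    Real.sqrt_sq h.le]

lemma graphSin_div_sqrt (a : ℝ → ℝ) (s : ℝ) :
    graphSin a s / √(1 - graphSin a s ^ 2) = deriv a s := by
  have hc := graphCos_pos a s
  rw [show 1 - graphSin a s ^ 2 = graphCos a s ^ 2 by linarith [graphSin_sq_add_graphCos_sq a s],
    Real.sqrt_sq hc.le, graphSin_eq]
  field_simp

lemma graphSin_lt_one (a : ℝ → ℝ) (s : ℝ) : graphSin a s < 1 := by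
  have := graphCos_pos a s
  nlinarith [graphSin_sq_add_graphCos_sq a s]

lemma contDiffOn_slope {n : WithTop ℕ∞} (hρ : ContDiffOn ℝ n ρ J)
    (h : ∀ s ∈ J, 0 < ρ s ∧ ρ s < 1) :
    ContDiffOn ℝ n (fun s => ρ s / √(1 - ρ s ^ 2)) J := by
  have h1 (s : ℝ) (hs : s ∈ J) : 0 < 1 - ρ s ^ 2 := by nlinarith [h s hs]
  exact hρ.div ((contDiffOn_const.sub (hρ.pow 2)).sqrt fun s hs => (h1 s hs).ne')
    fun s hs => (Real.sqrt_pos.2 (h1 s hs)).ne'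

lemma deriv_eq_of_integral_formula (hJo : IsOpen J) (hJ : J.OrdConnected) (hρ : ContinuousOn ρ J)
    (h : ∀ s ∈ J, 0 < ρ s ∧ ρ s < 1) (hs₀ : s₀ ∈ J)
    (ha : ∀ s ∈ J, a s = a s₀ + ∫ τ in s₀..s, ρ τ / √(1 - ρ τ ^ 2)) (hs : s ∈ J) :
    HasDerivAt a (ρ s / √(1 - ρ s ^ 2)) s := by
  have hc := (contDiffOn_slope (contDiffOn_zero.2 hρ) h).continuousOn
  refine ((hasDerivAt_integral_of_continuousOn hJo hJ hc hs₀ hs).const_add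
    (a s₀)).congr_of_eventuallyEq ?_
  filter_upwards [hJo.mem_nhds hs] with r hr using ha r hr

lemma integral_formula (hJo : IsOpen J) (hJ : J.OrdConnected) (ha : ContDiffOn ℝ ∞ a J)
    (hs₀ : s₀ ∈ J) (hs : s ∈ J) :
    a s = a s₀ + ∫ τ in s₀..s, graphSin a τ / √(1 - graphSin a τ ^ 2) := by
  simp only [graphSin_div_sqrt]
  rw [intervalIntegral.integral_eq_sub_of_hasDerivAt (f := a) (fun r hr => ?_)
    (intervalIntegrable_of_continuousOn_ordConnected hJ (contDiffOn_deriv hJo ha).continuousOn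
      hs₀ hs)]
  · ring
  · exact ((ha.contDiffAt (hJo.mem_nhds (hJ.uIcc_subset hs₀ hs hr))).differentiableAt
      (by simp)).hasDerivAt

end Slope

/-! ### Existence of constant mean curvature graphs and catenoids -/

section Existence

variable {E : Type*} [NormedAddCommGroup E] [NormedSpace ℝ E] [FiniteDimensional ℝ E]
  {M : Type*} [TopologicalSpace M] [ChartedSpace E M] [IsManifold 𝓘(ℝ, E) ∞ M]
  {E' : Type*} [NormedAddCommGroup E'] [NormedSpace ℝ E'] [FiniteDimensional ℝ E']
  {S : Type*} [TopologicalSpace S] [ChartedSpace E' S] [IsManifold 𝓘(ℝ, E') ∞ S]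
  {g : Bundle.ContMDiffRiemannianMetric 𝓘(ℝ, E) ∞ E (fun x : M => TangentSpace 𝓘(ℝ, E) x)}
  {f : ℝ → S → M} {J J' : Set ℝ} {a Hs : ℝ → ℝ} {H s₀ : ℝ}

lemma graphAngle_eq (x : S × ℝ) : graphAngle g.inner f a x = graphCos a x.2 := by
  have h : graphAngle g.inner f a x = coordMetric (prodMetric g.inner) (graphMap f a x)
    (coordGraphNormal f a x) ((0, 1) : E × ℝ) := rfl
  rw [h, coordMetric_prodMetric, coordGraphNormal_eq]
  simp

/-- The original base parameter may be lost in `J'`, but any `s₀` can replace it: the mean curvature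
condition already contains that `η_s` is a unit normal for each `s`. -/
lemma IsIsoparametric.mono (hI : IsIsoparametric 𝓘(ℝ, E') g.inner J f Hs) (hJ' : J' ⊆ J)
    (hopen : IsOpen J') (hord : J'.OrdConnected) (hs₀ : s₀ ∈ J') :
    IsIsoparametric 𝓘(ℝ, E') g.inner J' f Hs where
  left :=
    { isOpen := hopen
      ordConnected := hord
      smooth := hI.1.smooth.mono (prod_mono_right hJ')
      immersion := fun s hs => hI.1.immersion s (hJ' hs)
      geodesic := fun p => ⟨(hI.1.geodesic p).1.mono hJ', fun s hs =>
        (hI.1.geodesic p).2 s (hJ' hs)⟩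
      normal := ⟨s₀, hs₀, fun p => (hI.2 s₀ (hJ' hs₀) p (mem_univ p)).2.1⟩ }
  right := fun s hs => hI.2 s (hJ' hs)

/-- Every isoparametric family yields, locally in `s`, a graph of given constant mean curvature. -/
lemma IsIsoparametric.exists_graph [Nonempty S] (hI : IsIsoparametric 𝓘(ℝ, E') g.inner J f Hs)
    (hs₀ : s₀ ∈ J) (H : ℝ) {U : Set ℝ} (hU : U ∈ 𝓝 s₀) :
    ∃ J' ⊆ J ∩ U, s₀ ∈ J' ∧ ∃ a : ℝ → ℝ, IsParallelGraph 𝓘(ℝ, E') g.inner J' f a ∧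
      IsIsoparametric 𝓘(ℝ, E') g.inner J' f Hs ∧
      ∀ s ∈ J', deriv (graphSin a) s = Hs s * graphSin a s + H := by
  obtain ⟨p₀⟩ := ‹Nonempty S›
  obtain ⟨J', hJ', hopen, hord, hs₀', ρ, hρ, hode⟩ := exists_linear_ode_solution hI.1.isOpen
    hI.1.ordConnected (contDiffOn_meanCurvature g hI.1.isOpen hI.1.smooth p₀ hI.2) hs₀ H hU
  have hI' := hI.mono (fun s hs => (hJ' hs).1) hopen hord hs₀'
  set a : ℝ → ℝ := fun s => ∫ τ in s₀..s, ρ τ / √(1 - ρ τ ^ 2)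
  have hslope := contDiffOn_slope hρ fun s hs => (hode s hs).2
  have hda (s : ℝ) (hs : s ∈ J') : HasDerivAt a (ρ s / √(1 - ρ s ^ 2)) s :=
    hasDerivAt_integral_of_continuousOn hopen hord hslope.continuousOn hs₀' hs
  have hsin (s : ℝ) (hs : s ∈ J') : graphSin a s = ρ s :=
    graphSin_of_deriv_eq (hode s hs).2.1 (hode s hs).2.2 (hda s hs).deriv
  refine ⟨J', hJ', hs₀', a, ⟨hI'.1, contDiffOn_integral hopen hord hslope hs₀', fun s hs => ?_⟩,
    hI', fun s hs => ?_⟩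
  · rw [(hda s hs).deriv]
    have h := (hode s hs).2
    exact div_pos h.1 (Real.sqrt_pos.2 (by nlinarith))
  · rw [hsin s hs]
    refine ((hode s hs).1.congr_of_eventuallyEq ?_).deriv
    filter_upwards [hopen.mem_nhds hs] with r hr using hsin r hr

lemma IsParallelGraph.mfderiv_height (hG : IsParallelGraph 𝓘(ℝ, E') g.inner J f a) {s : ℝ}
    (hs : s ∈ J) (p : S) (w : E' × ℝ) :
    coordDeriv (𝓘(ℝ, E').prod 𝓘(ℝ, ℝ)) 𝓘(ℝ, ℝ) (fun y : S × ℝ => (graphMap f a y).2) (p, s) w =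
      deriv a s * w.2 := by
  have h2 : HasDerivAt a (deriv a s) s :=
    ((hG.smooth.contDiffAt (hG.parallel.isOpen.mem_nhds hs)).differentiableAt (by simp)).hasDerivAt
  have h3 := HasMFDerivAt.comp (p, s) h2.hasFDerivAt.hasMFDerivAt
    (hasMFDerivAt_snd (I := 𝓘(ℝ, E')) (I' := 𝓘(ℝ, ℝ)) (x := (p, s)))
  exact (congrArg (fun L : E' × ℝ →L[ℝ] ℝ => L w) h3.mfderiv).trans (mul_comm w.2 (deriv a s))

/-- A minimal graph over an isoparametric family without minimal members is a vertical
catenoid. -/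
lemma IsParallelGraph.graphIsVerticalCatenoid [Nonempty S]
    (hG : IsParallelGraph 𝓘(ℝ, E') g.inner J f a) (hs₀ : s₀ ∈ J)
    (hI : IsIsoparametric 𝓘(ℝ, E') g.inner J f Hs) (hH : ∀ s ∈ J, Hs s ≠ 0)
    (hode : ∀ s ∈ J, deriv (graphSin a) s = Hs s * graphSin a s) :
    GraphIsVerticalCatenoid 𝓘(ℝ, E') g.inner J f a := by
  -- The principal curvature along `∂_s` is `ρ'`, which equals `H_s ρ` by the minimal equation;
  -- dividing by `√(1 - θ²) = ρ` returns `H_s`.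
  refine ⟨fun x hx => ?_, ?_, fun x => Hs x.2 * graphSin a x.2, Hs, fun x hx => ?_, fun s hs =>
    ⟨hH s hs, hI.2 s hs, fun p => ?_⟩⟩
  · rw [graphAngle_eq]
    have h := hG.graphSin_pos hx.2
    have h2 := graphSin_sq_add_graphCos_sq a x.2
    nlinarith
  · rintro ⟨c, hc⟩
    obtain ⟨p⟩ := ‹Nonempty S›
    -- A constant angle would force `θ' = -a' H_s ρ` to vanish at `s₀`, although every factor is
    -- nonzero.
    have h1 := hasDerivAt_graphCos hG.parallel.isOpen hG.smooth hs₀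
    have h2 : graphCos a =ᶠ[𝓝 s₀] fun _ => c := by
      filter_upwards [hG.parallel.isOpen.mem_nhds hs₀] with s hs
      rw [← hc (p, s) ⟨mem_univ _, hs⟩, graphAngle_eq]
    have h3 := h1.unique ((hasDerivAt_const s₀ c).congr_of_eventuallyEq h2)
    rw [hode s₀ hs₀, neg_eq_zero] at h3
    exact mul_ne_zero (hG.deriv_pos s₀ hs₀).ne'
      (mul_ne_zero (hH s₀ hs₀) (hG.graphSin_pos hs₀).ne') h3
  · obtain ⟨p, s⟩ := x
    have hs : s ∈ J := hx.2
    obtain ⟨-, ⟨hunit, hnormal⟩, A, hA, -⟩ :=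
      hasConstMeanCurvatureOn_family_iff.1 (hI.2 s hs) p
    have ha := hG.deriv_pos s hs
    -- The image of `∂_s` has squared length `1 + a'²`, is orthogonal to the image of `E'`, and
    -- `dξ(∂_s) = a'`; so `∇ξ = a' / (1 + a'²) ∂_s`.
    have hT : 0 < deriv a s / (1 + deriv a s ^ 2) := by positivity
    refine ⟨mul_ne_zero (hH s hs) (hG.graphSin_pos hs).ne', _,
      ((0, deriv a s / (1 + deriv a s ^ 2)) : E' × ℝ), hG.coordDeriv_graphShape hs p hA, ?_, ?_, ?_⟩
    · have h (X : E' × ℝ) : coordMetric (prodMetric g.inner) (graphMap f a (p, s))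
          (coordDeriv (𝓘(ℝ, E').prod 𝓘(ℝ, ℝ)) (𝓘(ℝ, E).prod 𝓘(ℝ, ℝ)) (graphMap f a) (p, s)
            ((0, deriv a s / (1 + deriv a s ^ 2)) : E' × ℝ))
          (coordDeriv (𝓘(ℝ, E').prod 𝓘(ℝ, ℝ)) (𝓘(ℝ, E).prod 𝓘(ℝ, ℝ)) (graphMap f a) (p, s)
            X) =
          coordDeriv (𝓘(ℝ, E').prod 𝓘(ℝ, ℝ)) 𝓘(ℝ, ℝ) (fun y : S × ℝ => (graphMap f a y).2)
            (p, s) X := by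
        rw [hG.mfderiv_height hs, hG.coordDeriv_graphMap hs, hG.coordDeriv_graphMap hs,
          coordMetric_prodMetric]
        simp only [graphMap, map_zero, zero_add, map_smul, map_add, smul_apply, hunit, hnormal,
          smul_eq_mul]
        field_simp
        ring
      exact fun X => h X
    · exact fun h => hT.ne' (congrArg Prod.snd h)
    · refine Prod.ext ?_ ?_
      · exact (map_zero ((-graphSin a s) • A)).trans (smul_zero (Hs s * graphSin a s)).symm
      · change deriv (graphSin a) s * (deriv a s / (1 + deriv a s ^ 2)) =
          Hs s * graphSin a s * (deriv a s / (1 + deriv a s ^ 2))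
        rw [hode s hs]
  · have h := hG.graphSin_pos hs
    rw [graphAngle_eq, sqrt_one_sub_graphCos_sq h]
    field_simp

end Existence

end

theorem mainTheorem7 (m : ℕ) (hm : 1 ≤ m)
    (M : Type u) [TopologicalSpace M] [T2Space M] [SecondCountableTopology M]
    [ChartedSpace (EuclideanSpace ℝ (Fin (m + 1))) M] [IsManifold (𝓡 (m + 1)) ∞ M]
    (g : Bundle.ContMDiffRiemannianMetric (𝓡 (m + 1)) ∞ (EuclideanSpace ℝ (Fin (m + 1)))
      (fun x : M => TangentSpace (𝓡 (m + 1)) x)) :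
    -- isoparametric family and `a` given by the formula: the graph has mean curvature `H`
    (∀ (S : Type w) [TopologicalSpace S] [T2Space S] [SecondCountableTopology S]
      [ChartedSpace (EuclideanSpace ℝ (Fin m)) S] [IsManifold (𝓡 m) ∞ S]
      (J : Set ℝ) (f : ℝ → S → M) (a Hs ρ : ℝ → ℝ) (H : ℝ), ∀ s₀ ∈ J,
      IsParallelGraph (𝓡 m) g.inner J f a →
      IsIsoparametric (𝓡 m) g.inner J f Hs →
      (∀ s ∈ J, HasDerivAt ρ (Hs s * ρ s + H) s ∧ 0 < ρ s ∧ ρ s < 1) →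
      (∀ s ∈ J, a s = a s₀ + ∫ τ in s₀..s, ρ τ / √(1 - ρ τ ^ 2)) →
      GraphHasConstMeanCurvature (𝓡 m) g.inner J f a H) ∧
    -- the converse
    (∀ (S : Type w) [TopologicalSpace S] [T2Space S] [SecondCountableTopology S]
      [ChartedSpace (EuclideanSpace ℝ (Fin m)) S] [IsManifold (𝓡 m) ∞ S]
      (J : Set ℝ) (f : ℝ → S → M) (a : ℝ → ℝ) (H : ℝ),
      IsParallelGraph (𝓡 m) g.inner J f a →
      GraphHasConstMeanCurvature (𝓡 m) g.inner J f a H →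
      ∃ Hs ρ : ℝ → ℝ,
        IsIsoparametric (𝓡 m) g.inner J f Hs ∧
        (∀ s ∈ J, ∀ p : S, ρ s = deriv a s * graphAngle g.inner f a (p, s)) ∧
        (∀ s ∈ J, HasDerivAt ρ (Hs s * ρ s + H) s ∧ 0 < ρ s ∧ ρ s < 1) ∧
        (∀ s₀ ∈ J, ∀ s ∈ J, a s = a s₀ + ∫ τ in s₀..s, ρ τ / √(1 - ρ τ ^ 2))) ∧
    -- existence of graphs of constant mean curvature `H`, for each `H` (minimal: `H = 0`)
    (∀ H : ℝ,
      (∃ (S : Type w) (_ : TopologicalSpace S) (_ : T2Space S) (_ : SecondCountableTopology S)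
        (_ : ChartedSpace (EuclideanSpace ℝ (Fin m)) S) (_ : IsManifold (𝓡 m) ∞ S)
        (_ : Nonempty S) (J : Set ℝ) (f : ℝ → S → M) (a : ℝ → ℝ),
        IsParallelGraph (𝓡 m) g.inner J f a ∧
        GraphHasConstMeanCurvature (𝓡 m) g.inner J f a H) ↔
      (∃ (S : Type w) (_ : TopologicalSpace S) (_ : T2Space S) (_ : SecondCountableTopology S)
        (_ : ChartedSpace (EuclideanSpace ℝ (Fin m)) S) (_ : IsManifold (𝓡 m) ∞ S)
        (_ : Nonempty S) (J : Set ℝ) (f : ℝ → S → M) (Hs : ℝ → ℝ),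
        IsIsoparametric (𝓡 m) g.inner J f Hs)) ∧
    -- existence of vertical catenoids among the graphs
    ((∃ (S : Type w) (_ : TopologicalSpace S) (_ : T2Space S) (_ : SecondCountableTopology S)
        (_ : ChartedSpace (EuclideanSpace ℝ (Fin m)) S) (_ : IsManifold (𝓡 m) ∞ S)
        (_ : Nonempty S) (J : Set ℝ) (f : ℝ → S → M) (a : ℝ → ℝ),
        IsParallelGraph (𝓡 m) g.inner J f a ∧
        GraphIsVerticalCatenoid (𝓡 m) g.inner J f a) ↔
      (∃ (S : Type w) (_ : TopologicalSpace S) (_ : T2Space S) (_ : SecondCountableTopology S)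
        (_ : ChartedSpace (EuclideanSpace ℝ (Fin m)) S) (_ : IsManifold (𝓡 m) ∞ S)
        (_ : Nonempty S) (J : Set ℝ) (f : ℝ → S → M) (Hs : ℝ → ℝ),
        IsIsoparametric (𝓡 m) g.inner J f Hs ∧ ∃ s ∈ J, Hs s ≠ 0)) := by
  have converse : ∀ (S : Type w) [TopologicalSpace S]
      [ChartedSpace (EuclideanSpace ℝ (Fin m)) S] [IsManifold (𝓡 m) ∞ S]
      (J : Set ℝ) (f : ℝ → S → M) (a : ℝ → ℝ) (H : ℝ),
      IsParallelGraph (𝓡 m) g.inner J f a →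
      GraphHasConstMeanCurvature (𝓡 m) g.inner J f a H →
      IsIsoparametric (𝓡 m) g.inner J f
        (fun s => (deriv (graphSin a) s - H) / graphSin a s) :=
    fun S _ _ _ J f a H hG hH => ⟨hG.parallel, fun s hs => hG.hasConstMeanCurvatureOn hH hs⟩
  refine ⟨?_, ?_, fun H => ⟨?_, ?_⟩, ?_, ?_⟩
  · intro S _ _ _ _ _ J f a Hs ρ H s₀ hs₀ hG hI hode ha
    have hopen := hG.parallel.isOpen
    have hsin (s : ℝ) (hs : s ∈ J) : graphSin a s = ρ s :=
      graphSin_of_deriv_eq (hode s hs).2.1 (hode s hs).2.2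
        (deriv_eq_of_integral_formula hopen hG.parallel.ordConnected
          (fun r hr => (hode r hr).1.continuousAt.continuousWithinAt)
          (fun r hr => (hode r hr).2) hs₀ ha hs).deriv
    refine hG.graphHasConstMeanCurvature hI.2 fun s hs => ?_
    rw [hsin s hs]
    refine ((hode s hs).1.congr_of_eventuallyEq ?_).deriv
    filter_upwards [hopen.mem_nhds hs] with r hr using hsin r hr
  · intro S _ _ _ _ _ J f a H hG hH
    refine ⟨_, graphSin a, converse S J f a H hG hH, fun s hs p => ?_, fun s hs =>
      ⟨?_, hG.graphSin_pos hs, graphSin_lt_one a s⟩, fun s₀ hs₀ s hs =>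
      integral_formula hG.parallel.isOpen hG.parallel.ordConnected hG.smooth hs₀ hs⟩
    · rw [graphAngle_eq, graphSin_eq]
    · refine (hasDerivAt_graphSin hG.parallel.isOpen hG.smooth hs).congr_deriv ?_
      rw [div_mul_cancel₀ _ (hG.graphSin_pos hs).ne', sub_add_cancel]
  · rintro ⟨S, i₁, i₂, i₃, i₄, i₅, i₆, J, f, a, hG, hH⟩
    exact ⟨S, i₁, i₂, i₃, i₄, i₅, i₆, J, f, _, converse S J f a H hG hH⟩
  · rintro ⟨S, i₁, i₂, i₃, i₄, i₅, i₆, J, f, Hs, hI⟩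
    obtain ⟨s₀, hs₀, -⟩ := hI.1.normal
    obtain ⟨J', -, -, a, hG, hI', hode⟩ := hI.exists_graph hs₀ H univ_mem
    have hH := hG.graphHasConstMeanCurvature hI'.2 hode
    exact ⟨S, i₁, i₂, i₃, i₄, i₅, i₆, J', f, a, hG, hH⟩
  -- The condition on the horizontal sections already says that the family is isoparametric with
  -- nowhere vanishing mean curvature.
  · rintro ⟨S, i₁, i₂, i₃, i₄, i₅, i₆, J, f, a, hG, -, -, lam, h, -, hh⟩
    obtain ⟨s₀, hs₀, -⟩ := hG.parallel.normal
    exact ⟨S, i₁, i₂, i₃, i₄, i₅, i₆, J, f, h,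
      ⟨hG.parallel, fun s hs => (hh s hs).2.1⟩, s₀, hs₀, (hh s₀ hs₀).1⟩
  · rintro ⟨S, i₁, i₂, i₃, i₄, i₅, i₆, J, f, Hs, hI, s₀, hs₀, hne⟩
    have hcont := (contDiffOn_meanCurvature g hI.1.isOpen hI.1.smooth i₆.some hI.2).continuousOn
    -- The catenoid needs `H_s ≠ 0` at every parameter, so the interval is shrunk around `s₀`; there
    -- a minimal graph is taken.
    have hU : {s | Hs s ≠ 0} ∈ 𝓝 s₀ :=
      (hcont.continuousAt (hI.1.isOpen.mem_nhds hs₀)).eventually_ne hne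
    obtain ⟨J', hJ', hs₀', a, hG, hI', hode⟩ := hI.exists_graph hs₀ 0 hU
    have hC := hG.graphIsVerticalCatenoid hs₀' hI' (fun s hs => (hJ' hs).2) fun s hs => by
      rw [hode s hs, add_zero]
    exact ⟨S, i₁, i₂, i₃, i₄, i₅, i₆, J', f, a, hG, hC⟩
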